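/- For a finite group $G$ and $S\subseteq G$, let $\Gamma(G;S)$ be the undirected graph with vertex set $G$ in which distinct $g,h$ are adjacent if and only if $g^{-1}h\in S$ or $h^{-1}g\in S$, and let $\mathcal G(G,p)$ be the random graph $\Gamma(G;S)$ in which every element of $G$ is put into $S$ independently with probability $p$. Write $\mathrm{cl}(x)$ for the size of the conjugacy class of $x$, and call $x\in G$ an involution if $x^2=1$ (so the identity is counted). A disconnected graph has infinite diameter. There is a constant $\varepsilon_0>0$ such that the following holds for all fixed $\varepsilon\in(0,\varepsilon_0)$ and $\gamma\in(0,1)$. For $N\in\mathbb N$ put $$d_N=(1-\gamma)\sqrt{\frac{\log N}{2\log\log N}},\qquad M=\exp\left(2\sqrt{\log N\,\log\log N}\right).$$ Let $d$ be an integer with $2\le d\le d_N$, and let $G$ be a group of order $N$ such that (a) $G$ contains at most $N^{(2+\varepsilon)/4}$ involutions; (b) $G$ contains at most $N^{1/d}$ elements $x$ with $\mathrm{cl}(x)\le M$; (c) $G$ contains at most $N^{1/(2d)}$ involutions $x$ with $\mathrm{cl}(x)\le M$. If $p\in[0,1]$ satisfies $$p\ge\left(\frac{1+\varepsilon}{2^d}\cdot\frac{\log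 N}{N^{d-1}}\right)^{1/d},$$ then with high probability $\Gamma\in\mathcal G(G,p)$ has diameter at most $d$. That is, for every $\eta>0$ there is an $N_0$, depending only on $\varepsilon,\gamma,\eta$, such that for all $N\ge N_0$ and all $d,G,p$ as above the diameter of $\Gamma$ is at most $d$ with probability at least $1-\eta$. -/

import Mathlib

open scoped ProbabilityTheory unitInterval

/-- The undirected Cayley graph `Γ(G; S)`: distinct `g`, `h` are adjacent if and only if
`g⁻¹ * h ∈ S` or `h⁻¹ * g ∈ S` (loops and multiple edges are ignored). -/
def cayleyGraph {G : Type*} [Group G] (S : Set G) : SimpleGraph G :=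
  SimpleGraph.fromRel (fun g h => g⁻¹ * h ∈ S)

/-- The probability that `Γ ∈ 𝒢(G, p)` has diameter at most `d`: the generating set `S` contains
each element of `G` independently with probability `p`. The diameter is extended, that is, it is
`⊤` when the graph is disconnected. -/
noncomputable def probDiamLE (G : Type*) [Group G] (p : I) (d : ℕ) : ℝ :=
  (ProbabilityTheory.setBernoulli (Set.univ : Set G) p).real
    {S : Set G | (cayleyGraph S).ediam ≤ (d : ℕ∞)}

/-- `cl(x)`, the size of the conjugacy class of `x`. -/
noncomputable def classSize {G : Type*} [Group G] (x : G) : ℕ :=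
  (conjugatesOf x).ncard

/-- `d_N = (1 - γ) √(log N / (2 log log N))`. -/
noncomputable def diamRange (γ : ℝ) (N : ℕ) : ℝ :=
  (1 - γ) * Real.sqrt (Real.log N / (2 * Real.log (Real.log N)))

/-- `M = exp (2 √(log N · log log N))`. -/
noncomputable def classBound (N : ℕ) : ℝ :=
  Real.exp (2 * Real.sqrt (Real.log N * Real.log (Real.log N)))

/-! Write d = n + 1 and g = u⁻¹v. The vertices u, v are within distance d once g = y₀⋯yₙ with each
yᵢ or its inverse in S. Choosing signs, there are 2^d N^(d-1) signed words with value g, so at the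
threshold the expected number λ of them with all letters in S is (1+ε) log N. Janson's inequality
(`janson_inequality`) is applied to the sets of letters, and one set may come from several words:
rotations when g has a large centralizer, reversed inverse words when g² = 1. Thus, up to a small
proportion, there are at least 2^d N^(d-1)/s(g) sets, where s(g) ∈ {1, 2, d, 2d} is `symmetryBound`,
and g is missed with probability about exp(-λ/s(g)). Hypotheses (a), (b), (c) make the union bound
small over the classes s = 2, d, 2d. The algebraic core (`card_isExceptional_le`) is that no other
rearrangement matters. For consecutive letters a, b the equation of the word reads a = κb⁻¹, with κ
free of a and b. Substitute this in the rearranged word. If a, b carry the same sign there, b = v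
solves a conjugation equation, with at most |C(z)| solutions; unless a, b stay cyclically adjacent,
z runs over G as a third letter varies, and the commuting pairs of G are counted. If the signs
differ, v solves a square root equation, with at most the square root of the number of commuting
pairs as solutions. Hypothesis (b) bounds the number of commuting pairs by R² with R/N ≤ 3e^(-L), L
= √(log N · log log N). The range of d makes the number 2^d d! of signed permutations at most
e^(L/2), so atypical words are negligible. -/

/-! ### Random subsets of a finite set and Janson's inequality -/

/-- The expectation of `f S`, where `S ⊆ U` contains each element independently with
probability `p`. -/
noncomputable def bernoulliExp {α : Type*} [DecidableEq α] (p : ℝ) (U : Finset α)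
    (f : Finset α → ℝ) : ℝ :=
  ∑ S ∈ U.powerset, p ^ S.card * (1 - p) ^ (U \ S).card * f S

namespace bernoulliExp

variable {α : Type*} [DecidableEq α] {p : ℝ} {U : Finset α}

lemma insert_eq {a : α} (ha : a ∉ U) (f : Finset α → ℝ) :
    bernoulliExp p (insert a U) f =
      (1 - p) * bernoulliExp p U f + p * bernoulliExp p U (fun S => f (insert a S)) := by
  unfold bernoulliExp
  rw [Finset.sum_powerset_insert ha, Finset.mul_sum, Finset.mul_sum]
  congr 1
  · refine Finset.sum_congr rfl fun S hS => ?_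
    have hS' : a ∉ S := fun h => ha (Finset.mem_powerset.1 hS h)
    rw [Finset.insert_sdiff_of_notMem _ hS', Finset.card_insert_of_notMem (by simp [ha])]
    ring
  · refine Finset.sum_congr rfl fun S hS => ?_
    have hS' : a ∉ S := fun h => ha (Finset.mem_powerset.1 hS h)
    rw [Finset.card_insert_of_notMem hS', Finset.insert_sdiff_insert,
      Finset.sdiff_insert_of_notMem ha]
    ring

lemma congr_fun {f g : Finset α → ℝ} (h : ∀ S ⊆ U, f S = g S) :
    bernoulliExp p U f = bernoulliExp p U g :=
  Finset.sum_congr rfl fun S hS => by rw [h S (Finset.mem_powerset.1 hS)]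

lemma mono (hp0 : 0 ≤ p) (hp1 : p ≤ 1) {f g : Finset α → ℝ} (h : ∀ S, f S ≤ g S) :
    bernoulliExp p U f ≤ bernoulliExp p U g := by
  refine Finset.sum_le_sum fun S _ => mul_le_mul_of_nonneg_left (h S) ?_
  have : 0 ≤ 1 - p := by linarith
  positivity

lemma nonneg (hp0 : 0 ≤ p) (hp1 : p ≤ 1) {f : Finset α → ℝ} (h : ∀ S, 0 ≤ f S) :
    0 ≤ bernoulliExp p U f := by
  refine Finset.sum_nonneg fun S _ => mul_nonneg ?_ (h S)
  have : 0 ≤ 1 - p := by linarith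
  positivity

lemma const_mul (c : ℝ) (f : Finset α → ℝ) :
    bernoulliExp p U (fun S => c * f S) = c * bernoulliExp p U f := by
  unfold bernoulliExp
  rw [Finset.mul_sum]
  exact Finset.sum_congr rfl fun S _ => by ring

lemma sub (f g : Finset α → ℝ) :
    bernoulliExp p U (fun S => f S - g S) = bernoulliExp p U f - bernoulliExp p U g := by
  unfold bernoulliExp
  rw [← Finset.sum_sub_distrib]
  exact Finset.sum_congr rfl fun S _ => by ring

lemma sum {ι : Type*} (s : Finset ι) (f : ι → Finset α → ℝ) :
    bernoulliExp p U (fun S => ∑ i ∈ s, f i S) = ∑ i ∈ s, bernoulliExp p U (f i) := by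
  unfold bernoulliExp
  rw [Finset.sum_comm]
  exact Finset.sum_congr rfl fun S _ => by rw [Finset.mul_sum]

lemma one : bernoulliExp p U (fun _ => 1) = 1 := by
  induction U using Finset.induction_on with
  | empty => simp [bernoulliExp]
  | insert a U ha ih => rw [insert_eq ha, ih]; ring

/-- Allows Janson's inequality to be used at the threshold only, where the correlation term is
small. -/
lemma mono_prob {q : ℝ} (hp0 : 0 ≤ p) (hpq : p ≤ q) (hq1 : q ≤ 1) {f : Finset α → ℝ}
    (hf : Antitone f) : bernoulliExp q U f ≤ bernoulliExp p U f := by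
  induction U using Finset.induction_on generalizing f with
  | empty => simp [bernoulliExp]
  | insert a U ha ih =>
    rw [insert_eq ha, insert_eq ha]
    have h1 := ih hf
    have h2 := ih (f := fun S => f (insert a S))
      fun S T h => hf (Finset.insert_subset_insert a h)
    have h3 : bernoulliExp p U (fun S => f (insert a S)) ≤ bernoulliExp p U f :=
      mono hp0 (hpq.trans hq1) fun S => hf (Finset.subset_insert a S)
    nlinarith

/-- Conditioning on `a ∈ S`. -/
lemma mem_mul {a : α} (ha : a ∈ U) (f : Finset α → ℝ) :
    bernoulliExp p U (fun S => if a ∈ S then f S else 0) =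
      p * bernoulliExp p U (fun S => f (insert a S)) := by
  obtain ⟨V, hV, rfl⟩ : ∃ V, a ∉ V ∧ insert a V = U :=
    ⟨U.erase a, by simp, Finset.insert_erase ha⟩
  rw [insert_eq hV, insert_eq hV]
  have h1 : bernoulliExp p V (fun S => if a ∈ S then f S else 0) = 0 :=
    Finset.sum_eq_zero fun S hS => by
      simp [show a ∉ S from fun h => hV (Finset.mem_powerset.1 hS h)]
  have h2 : (fun S : Finset α => if a ∈ insert a S then f (insert a S) else 0) =
      fun S => f (insert a S) := by ext S; simp
  have h3 : (fun S : Finset α => f (insert a (insert a S))) = fun S => f (insert a S) := by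
    ext S; simp
  rw [h1, h2, h3]
  ring

/-- The case of Harris' inequality that Janson's needs: conditioning on `A ⊆ S` enlarges `S` and so
lowers an antitone `f`. -/
lemma subset_mul_le (hp0 : 0 ≤ p) (hp1 : p ≤ 1) {A : Finset α} (hA : A ⊆ U) {f : Finset α → ℝ}
    (hf : Antitone f) :
    bernoulliExp p U (fun S => if A ⊆ S then f S else 0) ≤ p ^ A.card * bernoulliExp p U f := by
  induction A using Finset.induction_on with
  | empty => simp
  | insert a A ha ih =>
    have h := ih ((Finset.subset_insert _ _).trans hA)
    have e : (fun S : Finset α => if insert a A ⊆ S then f S else 0) =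
        fun S => if a ∈ S then (if A ⊆ S then f S else 0) else 0 := by
      ext S; simp only [Finset.insert_subset_iff]; split_ifs <;> simp_all
    rw [e, mem_mul (hA (Finset.mem_insert_self _ _)), Finset.card_insert_of_notMem ha, pow_succ',
      mul_assoc]
    refine mul_le_mul_of_nonneg_left (le_trans (mono hp0 hp1 fun S => ?_) h) hp0
    simp only [Finset.subset_insert_iff_of_notMem ha]
    split_ifs
    · exact hf (Finset.subset_insert _ _)
    · exact le_rfl

/-- Independence: `f` does not look at the elements of `A`. -/
lemma subset_mul_eq {A : Finset α} (hA : A ⊆ U) {f : Finset α → ℝ}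
    (hf : ∀ a ∈ A, ∀ S, f (insert a S) = f S) :
    bernoulliExp p U (fun S => if A ⊆ S then f S else 0) = p ^ A.card * bernoulliExp p U f := by
  induction A using Finset.induction_on with
  | empty => simp
  | insert a A ha ih =>
    have h := ih ((Finset.subset_insert _ _).trans hA)
      fun b hb => hf b (Finset.mem_insert_of_mem hb)
    have e : (fun S : Finset α => if insert a A ⊆ S then f S else 0) =
        fun S => if a ∈ S then (if A ⊆ S then f S else 0) else 0 := by
      ext S; simp only [Finset.insert_subset_iff]; split_ifs <;> simp_all
    rw [e, mem_mul (hA (Finset.mem_insert_self _ _)), Finset.card_insert_of_notMem ha, pow_succ',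
      mul_assoc, ← h]
    congr 2
    ext S
    simp only [Finset.subset_insert_iff_of_notMem ha, hf a (Finset.mem_insert_self _ _)]

end bernoulliExp

open Classical in
/-- The indicator of the event that `S` contains no member of `F`. -/
noncomputable def avoidInd {α : Type*} (F : Finset (Finset α)) (S : Finset α) : ℝ :=
  if ∀ A ∈ F, ¬ A ⊆ S then 1 else 0

section Janson

variable {α : Type*} [DecidableEq α]

lemma avoidInd_nonneg (F : Finset (Finset α)) (S : Finset α) : 0 ≤ avoidInd F S := by
  unfold avoidInd; split_ifs <;> norm_num

lemma avoidInd_le_one (F : Finset (Finset α)) (S : Finset α) : avoidInd F S ≤ 1 := by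
  unfold avoidInd; split_ifs <;> norm_num

lemma avoidInd_antitone (F : Finset (Finset α)) : Antitone (avoidInd F) := by
  intro S T h
  unfold avoidInd
  by_cases hT : ∀ A ∈ F, ¬ A ⊆ T
  · rw [if_pos hT, if_pos fun A hA hS => hT A hA (hS.trans h)]
  · rw [if_neg hT]; split_ifs <;> norm_num

lemma avoidInd_anti_family {F F' : Finset (Finset α)} (h : F ⊆ F') (S : Finset α) :
    avoidInd F' S ≤ avoidInd F S := by
  unfold avoidInd
  by_cases hT : ∀ A ∈ F', ¬ A ⊆ S
  · rw [if_pos hT, if_pos fun A hA hS => hT A (h hA) hS]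
  · rw [if_neg hT]; split_ifs <;> norm_num

lemma avoidInd_insert_elem (F : Finset (Finset α)) {a : α} (h : ∀ A ∈ F, a ∉ A) (S : Finset α) :
    avoidInd F (insert a S) = avoidInd F S := by
  unfold avoidInd
  congr 1
  refine propext (forall₂_congr fun A hA => ?_)
  rw [Finset.subset_insert_iff_of_notMem (h A hA)]

lemma avoidInd_insert (F : Finset (Finset α)) (A S : Finset α) :
    avoidInd (insert A F) S = avoidInd F S - if A ⊆ S then avoidInd F S else 0 := by
  unfold avoidInd
  by_cases h : A ⊆ S
  · rw [if_neg fun h' => h' A (Finset.mem_insert_self _ _) h, if_pos h, sub_self]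
  · simp [h]

/-- The probability drops by P(A ⊆ S, S avoids F). With D the members of F disjoint from A, this is
at least P(A ⊆ S, S avoids D) minus the sum of P(A ∪ B ⊆ S, S avoids D) over the B meeting A.
Independence evaluates the first term, Harris bounds the others, and P(S avoids D) ≥ P(S avoids F).
-/
lemma janson_step {p : ℝ} {U : Finset α} (hp0 : 0 ≤ p) (hp1 : p ≤ 1) (F : Finset (Finset α))
    {A : Finset α} (hA : A ⊆ U) (hF : ∀ B ∈ F, B ⊆ U) :
    bernoulliExp p U (avoidInd (insert A F)) ≤ bernoulliExp p U (avoidInd F) *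
      (1 - (p ^ A.card - ∑ B ∈ F with ¬ Disjoint A B, p ^ (A ∪ B).card)) := by
  set c := p ^ A.card - ∑ B ∈ F with ¬ Disjoint A B, p ^ (A ∪ B).card with hc
  set D := F.filter fun B => Disjoint A B
  have e : bernoulliExp p U (avoidInd (insert A F)) = bernoulliExp p U (avoidInd F) -
      bernoulliExp p U (fun S => if A ⊆ S then avoidInd F S else 0) := by
    rw [← bernoulliExp.sub]
    exact bernoulliExp.congr_fun fun S _ => avoidInd_insert F A S
  have q0 : 0 ≤ bernoulliExp p U (avoidInd F) :=
    bernoulliExp.nonneg hp0 hp1 (avoidInd_nonneg F)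
  have qD : bernoulliExp p U (avoidInd F) ≤ bernoulliExp p U (avoidInd D) :=
    bernoulliExp.mono hp0 hp1 (avoidInd_anti_family (Finset.filter_subset _ _))
  suffices h : bernoulliExp p U (avoidInd F) * c ≤
      bernoulliExp p U (fun S => if A ⊆ S then avoidInd F S else 0) by
    rw [e]; linarith
  -- For negative `c` the bound is trivial; otherwise F may be replaced by D in the factor
  -- multiplying `c`.
  rcases lt_or_ge c 0 with hc0 | hc0
  · refine le_trans (mul_nonpos_of_nonneg_of_nonpos q0 hc0.le)
      (bernoulliExp.nonneg hp0 hp1 fun S => ?_)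
    split_ifs
    · exact avoidInd_nonneg F S
    · exact le_rfl
  calc bernoulliExp p U (avoidInd F) * c ≤ bernoulliExp p U (avoidInd D) * c :=
        mul_le_mul_of_nonneg_right qD hc0
    _ = p ^ A.card * bernoulliExp p U (avoidInd D) -
        ∑ B ∈ F with ¬ Disjoint A B, p ^ (A ∪ B).card * bernoulliExp p U (avoidInd D) := by
        rw [← Finset.sum_mul, hc]; ring
    _ ≤ bernoulliExp p U (fun S => if A ⊆ S then avoidInd D S else 0) -
        ∑ B ∈ F with ¬ Disjoint A B,
          bernoulliExp p U (fun S => if A ∪ B ⊆ S then avoidInd D S else 0) := by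
        refine sub_le_sub (le_of_eq ?_) (Finset.sum_le_sum fun B hB => ?_)
        · refine (bernoulliExp.subset_mul_eq hA fun a ha S => ?_).symm
          refine avoidInd_insert_elem D (fun B hB => ?_) S
          exact Finset.disjoint_left.1 (Finset.mem_filter.1 hB).2 ha
        · exact bernoulliExp.subset_mul_le hp0 hp1
            (Finset.union_subset hA (hF B (Finset.mem_filter.1 hB).1)) (avoidInd_antitone D)
    _ = bernoulliExp p U (fun S => (if A ⊆ S then avoidInd D S else 0) -
        ∑ B ∈ F with ¬ Disjoint A B, if A ∪ B ⊆ S then avoidInd D S else 0) := by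
        rw [bernoulliExp.sub, bernoulliExp.sum]
    _ ≤ _ := by
        refine bernoulliExp.mono hp0 hp1 fun S => ?_
        by_cases hAS : A ⊆ S
        · rw [if_pos hAS, if_pos hAS]
          by_cases hS : ∀ B ∈ F, ¬ B ⊆ S
          · have h1 : avoidInd F S = 1 := by rw [avoidInd, if_pos hS]
            rw [h1]
            refine le_trans (sub_le_self _ (Finset.sum_nonneg fun B _ => ?_)) (avoidInd_le_one D S)
            split_ifs
            · exact avoidInd_nonneg D S
            · exact le_rfl
          · push Not at hS
            obtain ⟨B, hB, hBS⟩ := hS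
            refine le_trans ?_ (avoidInd_nonneg F S)
            by_cases hd : Disjoint A B
            · have h1 : avoidInd D S = 0 := by
                rw [avoidInd, if_neg fun h => h B (Finset.mem_filter.2 ⟨hB, hd⟩) hBS]
              simp [h1]
            · rw [sub_nonpos]
              refine le_trans ?_ (Finset.single_le_sum (f := fun B => if A ∪ B ⊆ S then
                avoidInd D S else 0) (fun B _ => ?_) (Finset.mem_filter.2 ⟨hB, hd⟩))
              · rw [if_pos (Finset.union_subset hAS hBS)]
              · split_ifs
                · exact avoidInd_nonneg D S
                · exact le_rfl
        · rw [if_neg hAS, if_neg hAS, zero_sub, neg_nonpos]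
          refine Finset.sum_nonneg fun B _ => ?_
          split_ifs
          · exact avoidInd_nonneg D S
          · exact le_rfl

/-- **Janson's inequality** for the probability that a random set contains no member of `F`. -/
theorem janson_inequality {p : ℝ} {U : Finset α} (hp0 : 0 ≤ p) (hp1 : p ≤ 1)
    (F : Finset (Finset α)) (hF : ∀ B ∈ F, B ⊆ U) :
    bernoulliExp p U (avoidInd F) ≤ Real.exp (-(∑ A ∈ F, p ^ A.card) +
      ∑ A ∈ F, ∑ B ∈ F with B ≠ A ∧ ¬ Disjoint A B, p ^ (A ∪ B).card) := by
  induction F using Finset.induction_on with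
  | empty =>
    simp only [Finset.sum_empty, neg_zero, add_zero, Real.exp_zero]
    exact (bernoulliExp.mono hp0 hp1 (avoidInd_le_one ∅)).trans_eq bernoulliExp.one
  | insert A F hAF ih =>
    have ih' := ih fun B hB => hF B (Finset.mem_insert_of_mem hB)
    refine (janson_step hp0 hp1 F (hF A (Finset.mem_insert_self _ _))
      fun B hB => hF B (Finset.mem_insert_of_mem hB)).trans ?_
    refine (mul_le_mul_of_nonneg_left (Real.one_sub_le_exp_neg _)
      (bernoulliExp.nonneg hp0 hp1 (avoidInd_nonneg F))).trans ?_
    refine (mul_le_mul_of_nonneg_right ih' (Real.exp_pos _).le).trans ?_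
    rw [← Real.exp_add, Real.exp_le_exp, Finset.sum_insert hAF, Finset.sum_insert hAF]
    have h1 : ∑ B ∈ F with ¬ Disjoint A B, p ^ (A ∪ B).card ≤
        ∑ B ∈ insert A F with B ≠ A ∧ ¬ Disjoint A B, p ^ (A ∪ B).card := by
      refine Finset.sum_le_sum_of_subset_of_nonneg (fun B hB => ?_) fun _ _ _ => by positivity
      rw [Finset.mem_filter] at hB ⊢
      exact ⟨Finset.mem_insert_of_mem hB.1, fun h => hAF (h ▸ hB.1), hB.2⟩
    have h2 : ∑ A' ∈ F, ∑ B ∈ F with B ≠ A' ∧ ¬ Disjoint A' B, p ^ (A' ∪ B).card ≤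
        ∑ A' ∈ F, ∑ B ∈ insert A F with B ≠ A' ∧ ¬ Disjoint A' B, p ^ (A' ∪ B).card :=
      Finset.sum_le_sum fun A' _ => Finset.sum_le_sum_of_subset_of_nonneg
        (Finset.filter_subset_filter _ (Finset.subset_insert _ _)) fun _ _ _ => by positivity
    linarith

end Janson

/-! ### Centralizers, commuting pairs and square roots -/

section Centralizer

variable {G : Type*} [Group G] [Fintype G] [DecidableEq G]

/-- The order of the centralizer of `z`. -/
def centCard (z : G) : ℕ := (Finset.univ.filter fun v : G => v * z = z * v).card

variable (G) in
/-- The number of commuting pairs in `G`. -/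
def commPairs : ℕ := ∑ z : G, centCard z

/-- The solutions are empty or a coset of the centralizer of `z`. -/
lemma card_conj_eq_le_left (z k : G) :
    (Finset.univ.filter fun v : G => v⁻¹ * z * v = k).card ≤ centCard z := by
  by_cases h : ∃ w : G, w⁻¹ * z * w = k
  · obtain ⟨w, rfl⟩ := h
    refine Finset.card_le_card_of_injOn (fun v => v * w⁻¹) (fun v hv => ?_)
      (fun v _ v' _ h => mul_right_cancel h)
    simp only [Finset.coe_filter, Finset.mem_univ, true_and, Set.mem_ofPred_eq] at hv ⊢
    have : z * v = v * (w⁻¹ * z * w) := by rw [← hv]; group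
    rw [← mul_assoc, this]
    group
  · rw [Finset.card_eq_zero.2 (Finset.filter_eq_empty_iff.2 fun v _ hv => h ⟨v, hv⟩)]
    exact Nat.zero_le _

lemma card_conj_eq_le_right (z k : G) :
    (Finset.univ.filter fun v : G => v⁻¹ * z * v = k).card ≤ centCard k := by
  refine le_trans (Finset.card_le_card_of_injOn (fun v => v⁻¹) (fun v hv => ?_)
    (fun v _ v' _ h => inv_injective h)) (card_conj_eq_le_left k z)
  simp only [Finset.coe_filter, Finset.mem_univ, true_and, Set.mem_ofPred_eq] at hv ⊢
  rw [← hv]; group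

/-- If `x` and `x * t` are square roots of `h`, then `x` inverts `t`; hence the number of pairs of
square roots is at most the number of commuting pairs. -/
lemma card_sq_eq_sq_le (h : G) :
    (Finset.univ.filter fun x : G => x * x = h).card ^ 2 ≤ commPairs G := by
  rw [sq, ← Finset.card_product]
  rw [Finset.card_eq_sum_card_fiberwise (f := fun q : G × G => q.1⁻¹ * q.2) (t := Finset.univ)
    (fun _ _ => Finset.mem_coe.2 (Finset.mem_univ _))]
  refine Finset.sum_le_sum fun t _ => ?_
  refine le_trans ?_ (card_conj_eq_le_left t t⁻¹)
  refine Finset.card_le_card_of_injOn (fun q => q.1) (fun q hq => ?_) ?_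
  · simp only [Finset.coe_filter, Finset.mem_product, Finset.mem_filter, Finset.mem_univ, true_and,
      Set.mem_ofPred_eq] at hq ⊢
    obtain ⟨⟨h1, h2⟩, rfl⟩ := hq
    have h3 : q.2 * q.2 = q.1 * q.1 := by rw [h1, h2]
    have h4 : q.2 = q.1 * q.1 * q.2⁻¹ := by rw [← h3]; group
    calc q.1⁻¹ * (q.1⁻¹ * q.2) * q.1 = q.1⁻¹ * q.1⁻¹ * q.2 * q.1 := by group
      _ = q.1⁻¹ * q.1⁻¹ * (q.1 * q.1 * q.2⁻¹) * q.1 := by rw [← h4]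
      _ = (q.1⁻¹ * q.2)⁻¹ := by group
  · intro q hq q' hq' h
    simp only [Finset.coe_filter, Set.mem_ofPred_eq] at hq hq'
    have h1 : q.1 = q'.1 := h
    refine Prod.ext h1 ?_
    have : q.1⁻¹ * q.2 = q'.1⁻¹ * q'.2 := hq.2.trans hq'.2.symm
    rw [h1] at this
    exact mul_left_cancel this

/-- The equation says that `v * β` is a square root of a fixed element. -/
lemma card_sandwich_sq_le {R : ℕ} (hR : commPairs G ≤ R ^ 2) (α β γ g : G) :
    (Finset.univ.filter fun v : G => α * v * β * v * γ = g).card ≤ R := by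
  have h : (Finset.univ.filter fun v : G => α * v * β * v * γ = g).card ≤
      (Finset.univ.filter fun x : G => x * x = α⁻¹ * g * γ⁻¹ * β).card := by
    refine Finset.card_le_card_of_injOn (fun v => v * β) (fun v hv => ?_)
      (fun v _ v' _ h => mul_right_cancel h)
    simp only [Finset.coe_filter, Finset.mem_univ, true_and, Set.mem_ofPred_eq] at hv ⊢
    rw [← hv]; group
  exact h.trans ((Nat.pow_le_pow_iff_left two_ne_zero).1 ((card_sq_eq_sq_le _).trans hR))

lemma card_sandwich_inv_sq_le {R : ℕ} (hR : commPairs G ≤ R ^ 2) (α β γ g : G) :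
    (Finset.univ.filter fun v : G => α * v⁻¹ * β * v⁻¹ * γ = g).card ≤ R := by
  refine le_trans (Finset.card_le_card_of_injOn (fun v => v⁻¹) (fun v hv => ?_)
    (fun v _ v' _ h => inv_injective h)) (card_sandwich_sq_le hR α β γ g)
  simpa using hv

lemma centCard_mul_classSize (z : G) : centCard z * classSize z = Fintype.card G := by
  have h1 : classSize z = (MulAction.stabilizer (ConjAct G) z).index := by
    rw [MulAction.index_stabilizer, classSize]
    congr 1
    ext x
    rw [ConjAct.mem_orbit_conjAct]
    exact isConj_comm
  have h2 : centCard z = Nat.card (MulAction.stabilizer (ConjAct G) z) := by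
    rw [centCard, ← Fintype.card_subtype, ← Nat.card_eq_fintype_card]
    refine Nat.card_congr (Equiv.subtypeEquiv ConjAct.toConjAct.toEquiv fun v => ?_)
    rw [MulAction.mem_stabilizer_iff, MulEquiv.toEquiv_eq_coe, MulEquiv.coe_toEquiv,
      ConjAct.toConjAct_smul, mul_inv_eq_iff_eq_mul]
  rw [h1, h2, Subgroup.card_mul_index, ← Nat.card_eq_fintype_card]
  exact Nat.card_congr ConjAct.ofConjAct.toEquiv

lemma centCard_le_card (z : G) : centCard z ≤ Fintype.card G := Finset.card_le_univ _

lemma centCard_le_div {M : ℝ} (hM : 0 < M) {z : G} (hz : M < classSize z) :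
    (centCard z : ℝ) ≤ Fintype.card G / M := by
  rw [le_div_iff₀ hM, ← centCard_mul_classSize z, Nat.cast_mul]
  exact mul_le_mul_of_nonneg_left hz.le (Nat.cast_nonneg _)

lemma card_le_commPairs : Fintype.card G ≤ commPairs G := by
  rw [commPairs, ← Finset.card_univ, Finset.card_eq_sum_ones]
  exact Finset.sum_le_sum fun z _ => Finset.card_pos.2 ⟨1, by simp⟩

/-- An element with a class larger than `M` has centralizer of order at most |G|/M; for the few
others the bound |G| suffices. -/
lemma commPairs_le {M : ℝ} (hM : 0 < M) :
    (commPairs G : ℝ) ≤ Fintype.card G * {x : G | (classSize x : ℝ) ≤ M}.ncard +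
      (Fintype.card G : ℝ) ^ 2 / M := by
  classical
  have h1 : ∀ z : G, (centCard z : ℝ) ≤
      (if (classSize z : ℝ) ≤ M then (Fintype.card G : ℝ) else 0) + Fintype.card G / M := by
    intro z
    have h0 : (0 : ℝ) ≤ Fintype.card G / M := by positivity
    split_ifs with h
    · have : (centCard z : ℝ) ≤ Fintype.card G := by exact_mod_cast centCard_le_card z
      linarith
    · rw [zero_add]; exact centCard_le_div hM (not_le.1 h)
  rw [commPairs, Nat.cast_sum]
  refine (Finset.sum_le_sum fun z _ => h1 z).trans (le_of_eq ?_)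
  rw [Finset.sum_add_distrib, ← Finset.sum_filter, Finset.sum_const, Finset.sum_const,
    Finset.card_univ, nsmul_eq_mul, nsmul_eq_mul, Set.ncard_eq_toFinset_card', Set.toFinset_ofPred]
  ring

end Centralizer

/-! ### Counting solutions of pairs of word equations -/

section Words

variable {ι G : Type*} [Group G]

/-- The value of the word `l` when the letter `i` is replaced by `y i`. -/
def wordVal (y : ι → G) (l : List ι) : G := (l.map y).prod

@[simp] lemma wordVal_nil (y : ι → G) : wordVal y [] = 1 := rfl

@[simp] lemma wordVal_cons (y : ι → G) (i : ι) (l : List ι) :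
    wordVal y (i :: l) = y i * wordVal y l := by simp [wordVal]

@[simp] lemma wordVal_append (y : ι → G) (l l' : List ι) :
    wordVal y (l ++ l') = wordVal y l * wordVal y l' := by simp [wordVal]

lemma wordVal_congr {y y' : ι → G} {l : List ι} (h : ∀ i ∈ l, y i = y' i) :
    wordVal y l = wordVal y' l := by
  unfold wordVal
  rw [List.map_congr_left h]

lemma wordVal_update_of_notMem [DecidableEq ι] (y : ι → G) {c : ι} (w : G) {l : List ι}
    (h : c ∉ l) : wordVal (Function.update y c w) l = wordVal y l :=
  wordVal_congr fun i hi => Function.update_of_ne (fun e : i = c => h (e ▸ hi)) _ _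

lemma wordVal_update_injective [DecidableEq ι] (y : ι → G) {c : ι} {l : List ι}
    (hl : l.Nodup) (h : c ∈ l) : Function.Injective fun w => wordVal (Function.update y c w) l := by
  obtain ⟨l₁, l₂, rfl⟩ := List.append_of_mem h
  rw [List.nodup_middle, List.nodup_cons, List.mem_append, not_or] at hl
  intro w w' hw
  simpa [wordVal_update_of_notMem y _ hl.1.1, wordVal_update_of_notMem y _ hl.1.2] using hw

variable [Fintype ι] [DecidableEq ι] [Fintype G] [DecidableEq G]

lemma card_le_of_fiber_le {T : Finset (ι → G)} (s : Finset ι) {B : ℕ}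
    (h : ∀ y₀ : ι → G, (T.filter fun y => ∀ i ∉ s, y i = y₀ i).card ≤ B) :
    T.card ≤ Fintype.card G ^ (Fintype.card ι - s.card) * B := by
  have h1 := Finset.card_le_mul_card_image_of_maps_to (s := T)
    (t := (Finset.univ : Finset ({i // i ∉ s} → G))) (f := fun y i => y i.1)
    (fun _ _ => Finset.mem_univ _) B (fun z _ => ?_)
  · refine h1.trans (le_of_eq ?_)
    rw [Finset.card_univ, Fintype.card_fun, mul_comm]
    congr 2
    rw [Fintype.card_subtype_compl, Fintype.card_coe]
  · refine le_trans (Finset.card_le_card fun y hy => ?_)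
      -- The value 1 on `s` is a filler: the fiber condition does not see it.
      (h fun i => if hi : i ∉ s then z ⟨i, hi⟩ else 1)
    rw [Finset.mem_filter] at hy ⊢
    refine ⟨hy.1, fun i hi => ?_⟩
    rw [dif_pos hi, ← hy.2]

/-- If, with all letters but `a`, `b` fixed, the number of solutions is at most the order of the
centralizer of an element that is equidistributed as the letter `c` varies, then the number of
solutions is controlled by the number of commuting pairs. -/
lemma card_le_of_fiber_le_centCard {T : Finset (ι → G)} {a b c : ι} (hab : a ≠ b) (hca : c ≠ a)
    (hcb : c ≠ b) (Z : (ι → G) → G)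
    (h : ∀ y₀ : ι → G,
      (T.filter fun y => ∀ i ∉ ({a, b} : Finset ι), y i = y₀ i).card ≤ centCard (Z y₀))
    (hZ : ∀ y₀, Function.Injective fun w => Z (Function.update y₀ c w)) :
    T.card ≤ Fintype.card G ^ (Fintype.card ι - 3) * commPairs G := by
  have h3 : ({c, a, b} : Finset ι).card = 3 := by
    rw [Finset.card_insert_of_notMem (by simp [hca, hcb]), Finset.card_pair hab]
  rw [← h3]
  refine card_le_of_fiber_le _ fun y₀ => ?_
  rw [Finset.card_eq_sum_card_fiberwise (f := fun y : ι → G => y c) (t := Finset.univ)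
    (fun _ _ => Finset.mem_coe.2 (Finset.mem_univ _))]
  calc _ ≤ ∑ w : G, centCard (Z (Function.update y₀ c w)) := by
        refine Finset.sum_le_sum fun w _ => le_trans (Finset.card_le_card fun y hy => ?_)
          (h (Function.update y₀ c w))
        simp only [Finset.mem_filter, Finset.mem_insert, Finset.mem_singleton, not_or] at hy ⊢
        refine ⟨hy.1.1, fun i hi => ?_⟩
        by_cases hic : i = c
        · subst hic; rw [Function.update_self, hy.2]
        · rw [Function.update_of_ne hic]
          exact hy.1.2 i ⟨hic, hi⟩
    _ = commPairs G :=
        Fintype.sum_bijective _ (Finite.injective_iff_bijective.1 (hZ y₀)) _ _ fun _ => rfl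

/-- With all letters but `a`, `b` fixed, a solution of the first equation is determined by its
`b`-th letter. -/
lemma card_fiber_le_of_imp {T : Finset (ι → G)} {a b : ι} {l₀ l₃ : List ι} {g : G}
    (ha₀ : a ∉ l₀) (hb₀ : b ∉ l₀) (ha₃ : a ∉ l₃) (hb₃ : b ∉ l₃) (y₀ : ι → G)
    (hT : ∀ y ∈ T, wordVal y (l₀ ++ a :: b :: l₃) = g) {Q : G → Prop} [DecidablePred Q]
    (hQ : ∀ y ∈ T, (∀ i, i ≠ a → i ≠ b → y i = y₀ i) →
      y a = (wordVal y₀ l₀)⁻¹ * g * (wordVal y₀ l₃)⁻¹ * (y b)⁻¹ → Q (y b)) :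
    (T.filter fun y => ∀ i ∉ ({a, b} : Finset ι), y i = y₀ i).card ≤
      (Finset.univ.filter Q).card := by
  have key : ∀ y ∈ T.filter fun y => ∀ i ∉ ({a, b} : Finset ι), y i = y₀ i,
      y ∈ T ∧ (∀ i, i ≠ a → i ≠ b → y i = y₀ i) ∧
      y a = (wordVal y₀ l₀)⁻¹ * g * (wordVal y₀ l₃)⁻¹ * (y b)⁻¹ := by
    intro y hy
    simp only [Finset.mem_filter, Finset.mem_insert, Finset.mem_singleton, not_or, and_imp] at hy
    refine ⟨hy.1, hy.2, ?_⟩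
    have h1 : wordVal y l₀ = wordVal y₀ l₀ := wordVal_congr fun i hi =>
      hy.2 i (fun e => ha₀ (e ▸ hi)) (fun e => hb₀ (e ▸ hi))
    have h3 : wordVal y l₃ = wordVal y₀ l₃ := wordVal_congr fun i hi =>
      hy.2 i (fun e => ha₃ (e ▸ hi)) (fun e => hb₃ (e ▸ hi))
    rw [← hT y hy.1, wordVal_append, wordVal_cons, wordVal_cons, h1, h3]
    group
  refine Finset.card_le_card_of_injOn (fun y => y b) (fun y hy => ?_) ?_
  · obtain ⟨h1, h2, h3⟩ := key y hy
    simpa using hQ y h1 h2 h3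
  · intro y hy y' hy' h
    obtain ⟨-, h2, h3⟩ := key y hy
    obtain ⟨-, h2', h3'⟩ := key y' hy'
    have hb : y b = y' b := h
    funext i
    by_cases hia : i = a
    · rw [hia, h3, h3', hb]
    · by_cases hib : i = b
      · rw [hib, hb]
      · rw [h2 i hia hib, h2' i hia hib]

/-! ### Pairs of positive words: conjugation equations -/

section Unsigned

variable {a b : ι} {l₀ l₃ : List ι} (g g' : G)

/-- Eliminating `a` leaves v⁻¹ q v = const with v the letter `b`. Since `q` is nonempty, its value
runs over G as one of its letters varies. -/
lemma card_same_order_le (h₀ : (l₀ ++ a :: b :: l₃).Nodup) {p q r : List ι}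
    (h : (p ++ a :: (q ++ b :: r)).Nodup) (hq : q ≠ []) :
    (Finset.univ.filter fun y : ι → G => wordVal y (l₀ ++ a :: b :: l₃) = g ∧
      wordVal y (p ++ a :: (q ++ b :: r)) = g').card ≤
      Fintype.card G ^ (Fintype.card ι - 3) * commPairs G := by
  obtain ⟨c, hc⟩ := List.exists_mem_of_ne_nil q hq
  have hqn : q.Nodup := by
    have := h; simp only [List.nodup_append, List.nodup_cons] at this; grind
  have hq' : ∀ i ∈ q, i ≠ a ∧ i ≠ b := by
    simp only [List.nodup_append, List.nodup_cons] at h; grind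
  have hp' : ∀ i ∈ p, i ≠ a ∧ i ≠ b := by
    simp only [List.nodup_append, List.nodup_cons] at h; grind
  have hr' : ∀ i ∈ r, i ≠ a ∧ i ≠ b := by
    simp only [List.nodup_append, List.nodup_cons] at h; grind
  obtain ⟨ha₀, hb₀, ha₃, hb₃, hab⟩ : a ∉ l₀ ∧ b ∉ l₀ ∧ a ∉ l₃ ∧ b ∉ l₃ ∧ a ≠ b := by
    simp only [List.nodup_append, List.nodup_cons] at h₀; grind
  refine card_le_of_fiber_le_centCard hab (hq' c hc).1 (hq' c hc).2 (fun y => wordVal y q)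
    (fun y₀ => ?_) fun y₀ => wordVal_update_injective y₀ hqn hc
  refine le_trans (card_fiber_le_of_imp ha₀ hb₀ ha₃ hb₃ y₀ (g := g)
    (Q := fun v => v⁻¹ * wordVal y₀ q * v =
      (wordVal y₀ p * ((wordVal y₀ l₀)⁻¹ * g * (wordVal y₀ l₃)⁻¹))⁻¹ * g' * (wordVal y₀ r)⁻¹)
    (fun y hy => (Finset.mem_filter.1 hy).2.1) fun y hy h1 h2 => ?_) (card_conj_eq_le_left _ _)
  have e : ∀ l : List ι, (∀ i ∈ l, i ≠ a ∧ i ≠ b) → wordVal y l = wordVal y₀ l := fun l hl =>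
    wordVal_congr fun i hi => h1 i (hl i hi).1 (hl i hi).2
  have h3 := (Finset.mem_filter.1 hy).2.2
  rw [wordVal_append, wordVal_cons, wordVal_append, wordVal_cons, e p hp', e q hq', e r hr',
    h2] at h3
  rw [← h3]
  group

/-- Eliminating `a` now makes v conjugate q·l₀⁻¹·g·l₃⁻¹. A letter `c` of `p` or `r` is not in `q`,
so it occurs exactly once in this element, through `l₀` or `l₃`, and equidistributes it. -/
lemma card_reverse_order_le (h₀ : (l₀ ++ a :: b :: l₃).Nodup) {p q r : List ι}
    (h : (p ++ b :: (q ++ a :: r)).Nodup) (hpr : p ++ r ≠ [])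
    (hall : ∀ i, i ∈ l₀ ++ a :: b :: l₃) :
    (Finset.univ.filter fun y : ι → G => wordVal y (l₀ ++ a :: b :: l₃) = g ∧
      wordVal y (p ++ b :: (q ++ a :: r)) = g').card ≤
      Fintype.card G ^ (Fintype.card ι - 3) * commPairs G := by
  obtain ⟨c, hc⟩ := List.exists_mem_of_ne_nil (p ++ r) hpr
  rw [List.mem_append] at hc
  have hcq : c ∉ q := by
    simp only [List.nodup_append, List.nodup_cons] at h; grind
  have hq' : ∀ i ∈ q, i ≠ a ∧ i ≠ b := by
    simp only [List.nodup_append, List.nodup_cons] at h; grind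
  have hp' : ∀ i ∈ p, i ≠ a ∧ i ≠ b := by
    simp only [List.nodup_append, List.nodup_cons] at h; grind
  have hr' : ∀ i ∈ r, i ≠ a ∧ i ≠ b := by
    simp only [List.nodup_append, List.nodup_cons] at h; grind
  have hcab : c ≠ a ∧ c ≠ b := hc.elim (hp' c) (hr' c)
  obtain ⟨ha₀, hb₀, ha₃, hb₃, hab, hn₀, hn₃, hdisj⟩ :
      a ∉ l₀ ∧ b ∉ l₀ ∧ a ∉ l₃ ∧ b ∉ l₃ ∧ a ≠ b ∧ l₀.Nodup ∧ l₃.Nodup ∧ ∀ i ∈ l₀, i ∉ l₃ := by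
    simp only [List.nodup_append, List.nodup_cons] at h₀; grind
  refine card_le_of_fiber_le_centCard hab hcab.1 hcab.2
    (fun y => wordVal y q * ((wordVal y l₀)⁻¹ * g * (wordVal y l₃)⁻¹))
    (fun y₀ => ?_) fun y₀ => ?_
  · refine le_trans (card_fiber_le_of_imp ha₀ hb₀ ha₃ hb₃ y₀ (g := g)
      (Q := fun v => (v⁻¹)⁻¹ * (wordVal y₀ q * ((wordVal y₀ l₀)⁻¹ * g * (wordVal y₀ l₃)⁻¹)) * v⁻¹ =
        (wordVal y₀ p)⁻¹ * g' * (wordVal y₀ r)⁻¹)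
      (fun y hy => (Finset.mem_filter.1 hy).2.1) fun y hy h1 h2 => ?_)
      (le_trans (Finset.card_le_card_of_injOn (fun v => v⁻¹) (fun v hv => ?_)
        (fun v _ v' _ h => inv_injective h)) (card_conj_eq_le_left _
          ((wordVal y₀ p)⁻¹ * g' * (wordVal y₀ r)⁻¹)))
    · have e : ∀ l : List ι, (∀ i ∈ l, i ≠ a ∧ i ≠ b) → wordVal y l = wordVal y₀ l := fun l hl =>
        wordVal_congr fun i hi => h1 i (hl i hi).1 (hl i hi).2
      have h3 := (Finset.mem_filter.1 hy).2.2
      rw [wordVal_append, wordVal_cons, wordVal_append, wordVal_cons, e p hp', e q hq', e r hr',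
        h2] at h3
      rw [← h3]
      group
    · simpa using hv
  · intro w w' hw
    dsimp only at hw
    rw [wordVal_update_of_notMem _ _ hcq, wordVal_update_of_notMem _ _ hcq] at hw
    have hc' := hall c
    simp only [List.mem_append, List.mem_cons, hcab.1, hcab.2, false_or] at hc'
    rcases hc' with hc' | hc'
    · have hc3 := hdisj c hc'
      rw [wordVal_update_of_notMem _ _ hc3, wordVal_update_of_notMem _ _ hc3] at hw
      refine wordVal_update_injective y₀ hn₀ hc' ?_
      simpa using hw
    · have hc3 : c ∉ l₀ := fun hc0 => hdisj c hc0 hc'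
      rw [wordVal_update_of_notMem _ _ hc3, wordVal_update_of_notMem _ _ hc3] at hw
      refine wordVal_update_injective y₀ hn₃ hc' ?_
      simpa using hw

/-- With nothing outside `b … a`, no third letter need equidistribute the conjugated element (for a
true rotation it is always conjugate to `g`). The centralizer of the target `g'` is used instead. -/
lemma card_rotation_le (h₀ : (l₀ ++ a :: b :: l₃).Nodup) {q : List ι}
    (h : (b :: (q ++ [a])).Nodup) :
    (Finset.univ.filter fun y : ι → G => wordVal y (l₀ ++ a :: b :: l₃) = g ∧
      wordVal y (b :: (q ++ [a])) = g').card ≤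
      Fintype.card G ^ (Fintype.card ι - 2) * centCard g' := by
  have hq' : ∀ i ∈ q, i ≠ a ∧ i ≠ b := by
    simp only [List.nodup_append, List.nodup_cons] at h; grind
  obtain ⟨ha₀, hb₀, ha₃, hb₃, hab⟩ : a ∉ l₀ ∧ b ∉ l₀ ∧ a ∉ l₃ ∧ b ∉ l₃ ∧ a ≠ b := by
    simp only [List.nodup_append, List.nodup_cons] at h₀; grind
  rw [← Finset.card_pair hab]
  refine card_le_of_fiber_le _ fun y₀ => ?_
  refine le_trans (card_fiber_le_of_imp ha₀ hb₀ ha₃ hb₃ y₀ (g := g)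
      (Q := fun v => (v⁻¹)⁻¹ * (wordVal y₀ q * ((wordVal y₀ l₀)⁻¹ * g * (wordVal y₀ l₃)⁻¹)) * v⁻¹ =
        g')
      (fun y hy => (Finset.mem_filter.1 hy).2.1) fun y hy h1 h2 => ?_)
      (le_trans (Finset.card_le_card_of_injOn (fun v => v⁻¹) (fun v hv => ?_)
        (fun v _ v' _ h => inv_injective h)) (card_conj_eq_le_right
          (wordVal y₀ q * ((wordVal y₀ l₀)⁻¹ * g * (wordVal y₀ l₃)⁻¹)) _))
  · have h3 := (Finset.mem_filter.1 hy).2.2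
    rw [wordVal_cons, wordVal_append, wordVal_cons, wordVal_nil,
      wordVal_congr fun i hi => h1 i (hq' i hi).1 (hq' i hi).2, h2] at h3
    rw [← h3]
    group
  · simpa using hv

end Unsigned

/-- Two word equations in which the letters `a` and `b` have equal signs in the first word and
opposite signs in the second. -/
lemma card_mixed_le {R : ℕ} (hR : commPairs G ≤ R ^ 2) {a b : ι} {l₀ l₃ : List ι}
    (h₀ : (l₀ ++ a :: b :: l₃).Nodup) (s : ι → ℤˣ) (hs : s a ≠ s b) {L : List ι} (hL : L.Nodup)
    (haL : a ∈ L) (hbL : b ∈ L) (g g' : G) :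
    (Finset.univ.filter fun y : ι → G => wordVal y (l₀ ++ a :: b :: l₃) = g ∧
      wordVal (fun i => y i ^ (s i : ℤ)) L = g').card ≤
      Fintype.card G ^ (Fintype.card ι - 2) * R := by
  obtain ⟨ha₀, hb₀, ha₃, hb₃, hab⟩ : a ∉ l₀ ∧ b ∉ l₀ ∧ a ∉ l₃ ∧ b ∉ l₃ ∧ a ≠ b := by
    simp only [List.nodup_append, List.nodup_cons] at h₀; grind
  rw [← Finset.card_pair hab]
  refine card_le_of_fiber_le _ fun y₀ => ?_
  set κ := (wordVal y₀ l₀)⁻¹ * g * (wordVal y₀ l₃)⁻¹ with hκ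
  have hcases : (s a = 1 ∧ s b = -1) ∨ (s a = -1 ∧ s b = 1) := by
    rcases Int.units_eq_one_or (s a) with h | h <;> rcases Int.units_eq_one_or (s b) with h' | h' <;>
      simp_all
  set y₁ : ι → G := fun i => y₀ i ^ (s i : ℤ) with hy₁
  have hdec : ∃ p q r : List ι, (L = p ++ a :: (q ++ b :: r) ∨ L = p ++ b :: (q ++ a :: r)) := by
    obtain ⟨p, t, rfl⟩ := List.append_of_mem haL
    simp only [List.mem_append, List.mem_cons, hab.symm, false_or] at hbL
    rcases hbL with hb | hb
    · obtain ⟨p', q, rfl⟩ := List.append_of_mem hb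
      exact ⟨p', q, t, Or.inr (by simp)⟩
    · obtain ⟨q, r, rfl⟩ := List.append_of_mem hb
      exact ⟨p, q, r, Or.inl rfl⟩
  obtain ⟨p, q, r, hpqr⟩ := hdec
  have hn : ∀ l, l = p ∨ l = q ∨ l = r → ∀ i ∈ l, i ≠ a ∧ i ≠ b := by
    rcases hpqr with rfl | rfl <;>
    · simp only [List.nodup_append, List.nodup_cons] at hL; grind
  have e : ∀ y : ι → G, (∀ i, i ≠ a → i ≠ b → y i = y₀ i) → ∀ l, l = p ∨ l = q ∨ l = r →
      wordVal (fun i => y i ^ (s i : ℤ)) l = wordVal y₁ l := fun y h1 l hl =>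
    wordVal_congr fun i hi => by rw [hy₁, h1 i (hn l hl i hi).1 (hn l hl i hi).2]
  have hmem : ∀ y ∈ (Finset.univ.filter fun y : ι → G => wordVal y (l₀ ++ a :: b :: l₃) = g ∧
      wordVal (fun i => y i ^ (s i : ℤ)) L = g'), wordVal y (l₀ ++ a :: b :: l₃) = g :=
    fun y hy => (Finset.mem_filter.1 hy).2.1
  -- With a = κv⁻¹ and b = v, opposite signs on `a` and `b` give v the same exponent in both places,
  -- hence a square root equation in all four cases.
  rcases hpqr with hL' | hL' <;> rcases hcases with ⟨hsa, hsb⟩ | ⟨hsa, hsb⟩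
  · refine le_trans (card_fiber_le_of_imp ha₀ hb₀ ha₃ hb₃ y₀ (Q := fun v =>
      (wordVal y₁ p * κ) * v⁻¹ * wordVal y₁ q * v⁻¹ * wordVal y₁ r = g')
      hmem fun y hy h1 h2 => ?_) (card_sandwich_inv_sq_le hR _ _ _ _)
    rw [← (Finset.mem_filter.1 hy).2.2, hL']
    simp only [wordVal_append, wordVal_cons, e y h1, true_or, or_true, hsa, hsb, h2]
    simp [mul_assoc, hκ]
  · refine le_trans (card_fiber_le_of_imp ha₀ hb₀ ha₃ hb₃ y₀ (Q := fun v =>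
      wordVal y₁ p * v * (κ⁻¹ * wordVal y₁ q) * v * wordVal y₁ r = g')
      hmem fun y hy h1 h2 => ?_) (card_sandwich_sq_le hR _ _ _ _)
    rw [← (Finset.mem_filter.1 hy).2.2, hL']
    simp only [wordVal_append, wordVal_cons, e y h1, true_or, or_true, hsa, hsb, h2]
    simp [mul_assoc, hκ]
  · refine le_trans (card_fiber_le_of_imp ha₀ hb₀ ha₃ hb₃ y₀ (Q := fun v =>
      wordVal y₁ p * v⁻¹ * (wordVal y₁ q * κ) * v⁻¹ * wordVal y₁ r = g')
      hmem fun y hy h1 h2 => ?_) (card_sandwich_inv_sq_le hR _ _ _ _)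
    rw [← (Finset.mem_filter.1 hy).2.2, hL']
    simp only [wordVal_append, wordVal_cons, e y h1, true_or, or_true, hsa, hsb, h2]
    simp [mul_assoc, hκ]
  · refine le_trans (card_fiber_le_of_imp ha₀ hb₀ ha₃ hb₃ y₀ (Q := fun v =>
      wordVal y₁ p * v * wordVal y₁ q * v * (κ⁻¹ * wordVal y₁ r) = g')
      hmem fun y hy h1 h2 => ?_) (card_sandwich_sq_le hR _ _ _ _)
    rw [← (Finset.mem_filter.1 hy).2.2, hL']
    simp only [wordVal_append, wordVal_cons, e y h1, true_or, or_true, hsa, hsb, h2]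
    simp [mul_assoc, hκ]

end Words

/-! ### Signed permutations of a word -/

section SignedPerm

lemma exists_ofFn_eq_append {m : ℕ} {β : Type*} (f : Fin m → β) {i j : Fin m}
    (h : (i : ℕ) + 1 = j) : ∃ l₀ l₃, List.ofFn f = l₀ ++ f i :: f j :: l₃ := by
  refine ⟨(List.ofFn f).take i, (List.ofFn f).drop (i + 2), ?_⟩
  have h1 : (i : ℕ) < (List.ofFn f).length := by simp
  have h2 : (i : ℕ) + 1 < (List.ofFn f).length := by simp [h]
  conv_lhs => rw [← List.take_append_drop i (List.ofFn f), List.drop_eq_getElem_cons h1,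
    List.drop_eq_getElem_cons h2]
  rw [List.getElem_ofFn, List.getElem_ofFn]
  have hj : (i : ℕ) + 2 = j + 1 := by omega
  simp only [h, hj]

variable {n : ℕ}

/-- The permutation `π` of `0, 1, …, n` is a cyclic rotation. -/
def IsCyclicOrder (π : Equiv.Perm (Fin (n + 1))) : Prop :=
  -- Positions are added modulo n + 1, so `a` in last place and its successor in first place count
  -- as consecutive.
  ∀ a : Fin n, π.symm a.succ = π.symm a.castSucc + 1

lemma IsCyclicOrder.ext {π π' : Equiv.Perm (Fin (n + 1))} (h : IsCyclicOrder π)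
    (h' : IsCyclicOrder π') (h0 : π.symm 0 = π'.symm 0) : π = π' := by
  have : π.symm = π'.symm := by
    ext1 i
    induction i using Fin.induction with
    | zero => exact h0
    | succ a ih => rw [h a, h' a, ih]
  simpa using congrArg Equiv.symm this

variable {G : Type*} [Group G]

lemma wordVal_ofFn {m : ℕ} {ι : Type*} (y : ι → G) (f : Fin m → ι) :
    wordVal y (List.ofFn f) = (List.ofFn fun i => y (f i)).prod := by
  rw [wordVal, List.map_ofFn]; rfl

lemma ofFn_revPerm_trans {m : ℕ} {β : Type*} (f : Fin m → β) :
    List.ofFn (fun i => f (Fin.rev i)) = (List.ofFn f).reverse := by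
  refine List.ext_getElem (by simp) fun i h1 h2 => ?_
  simp only [List.getElem_ofFn, List.getElem_reverse, List.length_ofFn]
  congr 1
  ext
  simp only [Fin.val_rev]
  omega

lemma wordVal_inv_ofFn {m : ℕ} (y : Fin m → G) (π : Equiv.Perm (Fin m)) :
    wordVal (fun i => (y i)⁻¹) (List.ofFn π) =
      (wordVal y (List.ofFn (Fin.revPerm.trans π)))⁻¹ := by
  have : (Fin.revPerm.trans π : Fin m → Fin m) = fun i => π (Fin.rev i) := by
    ext i; simp
  rw [this, ofFn_revPerm_trans, wordVal, wordVal, List.prod_inv_reverse, List.map_reverse,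
    List.map_reverse, List.reverse_reverse, List.map_map]
  rfl

/-- The order in which the letters occur in the signed permutation `τ` of the word `0 1 ⋯ n`, read
backwards if the signs are not all positive. -/
noncomputable def readingOrder (τ : Equiv.Perm (Fin (n + 1)) × (Fin (n + 1) → ℤˣ)) :
    Equiv.Perm (Fin (n + 1)) :=
  open Classical in if τ.2 = 1 then τ.1 else Fin.revPerm.trans τ.1

/-- The value of the word obtained from `0 1 ⋯ n` by the signed permutation `τ`. -/
def signedVal (y : Fin (n + 1) → G) (τ : Equiv.Perm (Fin (n + 1)) × (Fin (n + 1) → ℤˣ)) : G :=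
  -- Signs are indexed by letters, not by positions.
  wordVal (fun i => y i ^ (τ.2 i : ℤ)) (List.ofFn τ.1)

/-- The signed permutation `τ` preserves or reverses the cyclic order of `0, 1, …, n`. -/
def IsDihedral (τ : Equiv.Perm (Fin (n + 1)) × (Fin (n + 1) → ℤˣ)) : Prop :=
  (τ.2 = 1 ∨ τ.2 = -1) ∧ IsCyclicOrder (readingOrder τ)

lemma neg_one_ne_one_fun : (-1 : Fin (n + 1) → ℤˣ) ≠ 1 := fun h => by
  have := congrFun h 0
  simp at this

lemma signedVal_eq_of_eq_one (y : Fin (n + 1) → G)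
    {τ : Equiv.Perm (Fin (n + 1)) × (Fin (n + 1) → ℤˣ)} (h : τ.2 = 1) :
    signedVal y τ = wordVal y (List.ofFn (readingOrder τ)) := by
  rw [signedVal, readingOrder, if_pos h, h]
  simp

lemma signedVal_eq_of_eq_neg_one (y : Fin (n + 1) → G)
    {τ : Equiv.Perm (Fin (n + 1)) × (Fin (n + 1) → ℤˣ)} (h : τ.2 = -1) :
    signedVal y τ = (wordVal y (List.ofFn (readingOrder τ)))⁻¹ := by
  rw [signedVal, readingOrder, if_neg (by rw [h]; exact neg_one_ne_one_fun), h,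
    ← wordVal_inv_ofFn]
  simp

variable [Fintype G] [DecidableEq G]

/-- Some a, a + 1 are not cyclically consecutive in π. If a comes first, letters lie between them;
if a + 1 comes first, letters lie outside them. In either case a third letter is available for
equidistribution. -/
lemma card_not_isCyclicOrder_le {π : Equiv.Perm (Fin (n + 1))} (hπ : ¬ IsCyclicOrder π) (g g' : G) :
    (Finset.univ.filter fun y : Fin (n + 1) → G => wordVal y (List.ofFn id) = g ∧
      wordVal y (List.ofFn π) = g').card ≤ Fintype.card G ^ (n + 1 - 3) * commPairs G := by
  unfold IsCyclicOrder at hπ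
  push Not at hπ
  obtain ⟨a, ha⟩ := hπ
  obtain ⟨l₀, l₃, h₀⟩ := exists_ofFn_eq_append (id : Fin (n + 1) → Fin (n + 1))
    (i := a.castSucc) (j := a.succ) (by simp)
  simp only [id] at h₀
  have hn₀ : (List.ofFn (id : Fin (n + 1) → Fin (n + 1))).Nodup :=
    List.nodup_ofFn.2 Function.injective_id
  have hmem : ∀ i, i ∈ List.ofFn (id : Fin (n + 1) → Fin (n + 1)) := fun i =>
    List.mem_ofFn.2 ⟨i, rfl⟩
  have hn : (List.ofFn π).Nodup := List.nodup_ofFn.2 π.injective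
  have haL : a.castSucc ∈ List.ofFn π := List.mem_ofFn.2 ⟨_, π.apply_symm_apply _⟩
  have hbL : a.succ ∈ List.ofFn π := List.mem_ofFn.2 ⟨_, π.apply_symm_apply _⟩
  have hab : a.succ ≠ a.castSucc := (Fin.castSucc_lt_succ (i := a)).ne'
  rw [h₀] at hn₀ hmem
  have hcard : Fintype.card (Fin (n + 1)) = n + 1 := Fintype.card_fin _
  have hget : ∀ (l l' : List (Fin (n + 1))) (c : Fin (n + 1)), List.ofFn π = l ++ c :: l' →
      ((π.symm c : Fin (n + 1)) : ℕ) = l.length := by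
    intro l l' c hc
    have hk : l.length < (List.ofFn π).length := by rw [hc]; simp
    have h1 : (List.ofFn π)[l.length] = c := by simp only [hc]; simp
    rw [List.getElem_ofFn] at h1
    rw [← h1, π.symm_apply_apply]
  have hlen : (List.ofFn π).length = n + 1 := List.length_ofFn
  obtain ⟨p, t, hpt⟩ := List.append_of_mem haL
  rw [hpt] at hbL
  simp only [List.mem_append, List.mem_cons, hab, false_or] at hbL
  rcases hbL with hb | hb
  · obtain ⟨p', q, rfl⟩ := List.append_of_mem hb
    have hL : List.ofFn π = p' ++ a.succ :: (q ++ a.castSucc :: t) := by rw [hpt]; simp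
    rw [hL] at hn
    have hne : p' ++ t ≠ [] := by
      intro h
      rw [List.append_eq_nil_iff] at h
      obtain ⟨rfl, rfl⟩ := h
      rw [hL] at hlen
      simp only [List.nil_append, List.length_cons, List.length_append, List.length_nil] at hlen
      have h1 := hget [] (q ++ [a.castSucc]) a.succ hL
      have h2 := hget (a.succ :: q) [] a.castSucc hpt
      refine ha (Fin.ext ?_)
      rw [h1]
      have h3 : π.symm a.castSucc = Fin.last n := Fin.ext (by
        rw [h2, Fin.val_last, List.length_cons]; omega)
      rw [h3, Fin.last_add_one]
      rfl
    have := card_reverse_order_le g g' hn₀ hn hne hmem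
    rwa [hcard, ← hL, ← h₀] at this
  · obtain ⟨q, r, rfl⟩ := List.append_of_mem hb
    rw [hpt] at hn
    have hne : q ≠ [] := by
      rintro rfl
      rw [hpt] at hlen
      simp only [List.nil_append, List.length_cons, List.length_append] at hlen
      have h1 := hget p (a.succ :: r) a.castSucc hpt
      have h2 := hget (p ++ [a.castSucc]) r a.succ (by simpa using hpt)
      refine ha (Fin.ext ?_)
      rw [h2, Fin.val_add_one_of_lt, h1, List.length_append, List.length_singleton]
      rw [Fin.lt_def, h1, Fin.val_last]
      omega
    have := card_same_order_le g g' hn₀ hn hne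
    rwa [hcard, ← hpt, ← h₀] at this

/-- A nontrivial rotation starts with some a + 1 and therefore ends with a. -/
lemma card_isCyclicOrder_le {π : Equiv.Perm (Fin (n + 1))} (hπ : IsCyclicOrder π)
    (h0 : π.symm 0 ≠ 0) (g g' : G) :
    (Finset.univ.filter fun y : Fin (n + 1) → G => wordVal y (List.ofFn id) = g ∧
      wordVal y (List.ofFn π) = g').card ≤ Fintype.card G ^ (n + 1 - 2) * centCard g' := by
  have hb0 : π 0 ≠ 0 := fun h => h0 (by rw [Equiv.symm_apply_eq, h])
  obtain ⟨a, ha⟩ := Fin.exists_succ_eq.2 hb0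
  have h1 : π.symm a.castSucc = Fin.last n := by
    have h2 := hπ a
    rw [ha, π.symm_apply_apply, ← Fin.last_add_one, add_left_inj] at h2
    exact h2.symm
  obtain ⟨m, rfl⟩ : ∃ m, n = m + 1 := ⟨n - 1, by have := a.pos; omega⟩
  have hL : List.ofFn π = a.succ ::
      ((List.ofFn fun i : Fin m => π i.castSucc.succ) ++ [a.castSucc]) := by
    rw [List.ofFn_succ, List.ofFn_succ', List.concat_eq_append, ha, Fin.succ_last, ← h1,
      π.apply_symm_apply]
  obtain ⟨l₀, l₃, h₀⟩ := exists_ofFn_eq_append (id : Fin (m + 1 + 1) → Fin (m + 1 + 1))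
    (i := a.castSucc) (j := a.succ) (by simp)
  simp only [id] at h₀
  have hn₀ : (List.ofFn (id : Fin (m + 1 + 1) → Fin (m + 1 + 1))).Nodup :=
    List.nodup_ofFn.2 Function.injective_id
  have hn : (List.ofFn π).Nodup := List.nodup_ofFn.2 π.injective
  rw [hL] at hn
  rw [h₀] at hn₀
  have := card_rotation_le g g' hn₀ hn
  rwa [Fintype.card_fin, ← hL, ← h₀] at this

lemma centCard_inv (g : G) : centCard g⁻¹ = centCard g := by
  unfold centCard
  congr 1
  ext v
  simp only [Finset.mem_filter, Finset.mem_univ, true_and]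
  exact ⟨fun h => (Commute.inv_right_iff.1 h), fun h => Commute.inv_right h⟩

/-- Signed permutations of a word that can only exceptionally leave its value unchanged. -/
def IsExceptional (R : ℕ) (g : G) (τ : Equiv.Perm (Fin (n + 1)) × (Fin (n + 1) → ℤˣ)) : Prop :=
  ¬ IsDihedral τ ∨ (centCard g ≤ R ∧ (readingOrder τ).symm 0 ≠ 0)

/-- Non-constant signs differ at two consecutive letters and lead to square roots. Constant signs
reduce, after inverting the word if they are negative, to a positive permutation: either not cyclic,
or a proper rotation with |C(g)| ≤ R. -/
lemma card_isExceptional_le {R : ℕ} (hR : commPairs G ≤ R ^ 2)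
    (hR' : commPairs G ≤ Fintype.card G * R) (g : G)
    {τ : Equiv.Perm (Fin (n + 1)) × (Fin (n + 1) → ℤˣ)} (hτ : IsExceptional R g τ) :
    (Finset.univ.filter fun y : Fin (n + 1) → G => wordVal y (List.ofFn id) = g ∧
      signedVal y τ = g).card ≤ Fintype.card G ^ (n + 1 - 2) * R := by
  have hconst : (τ.2 = 1 ∨ τ.2 = -1) → (Finset.univ.filter fun y : Fin (n + 1) → G =>
      wordVal y (List.ofFn id) = g ∧ signedVal y τ = g).card ≤
        Fintype.card G ^ (n + 1 - 2) * R := by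
    intro h
    obtain ⟨g', hg', hcg⟩ : ∃ g' : G, (∀ y : Fin (n + 1) → G, signedVal y τ = g ↔
        wordVal y (List.ofFn (readingOrder τ)) = g') ∧ centCard g' = centCard g := by
      rcases h with h | h
      · exact ⟨g, fun y => by rw [signedVal_eq_of_eq_one y h], rfl⟩
      · exact ⟨g⁻¹, fun y => by rw [signedVal_eq_of_eq_neg_one y h, inv_eq_iff_eq_inv],
          centCard_inv g⟩
    simp only [hg']
    by_cases hc : IsCyclicOrder (readingOrder τ)
    · rcases hτ with hτ | hτ
      · exact absurd ⟨h, hc⟩ hτ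
      · refine (card_isCyclicOrder_le hc hτ.2 g g').trans (Nat.mul_le_mul_left _ ?_)
        rw [hcg]; exact hτ.1
    -- Every permutation of at most two letters is cyclic, so the subtraction in the exponent n + 1
    -- - 3 is not truncated.
    · have h3 : 3 ≤ n + 1 := by
        by_contra hn
        refine hc fun a => ?_
        obtain rfl : n = 1 := by have := a.pos; omega
        have h1 : (readingOrder τ).symm a.succ ≠ (readingOrder τ).symm a.castSucc :=
          fun h => (Fin.castSucc_lt_succ (i := a)).ne' ((readingOrder τ).symm.injective h)
        generalize (readingOrder τ).symm a.succ = u at h1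
        generalize (readingOrder τ).symm a.castSucc = v at h1
        fin_cases u <;> fin_cases v <;> simp_all
      refine (card_not_isCyclicOrder_le hc g g').trans ?_
      obtain ⟨k, hk⟩ : ∃ k, n + 1 = k + 3 := ⟨n + 1 - 3, by omega⟩
      rw [hk, show k + 3 - 3 = k by omega, show k + 3 - 2 = k + 1 by omega, pow_succ, mul_assoc]
      exact Nat.mul_le_mul_left _ hR'
  by_cases hs : ∀ a : Fin n, τ.2 a.castSucc = τ.2 a.succ
  · refine hconst ?_
    have h0 : ∀ i, τ.2 i = τ.2 0 := fun i => by
      induction i using Fin.induction with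
      | zero => rfl
      | succ a ih => rw [← hs a, ih]
    rcases Int.units_eq_one_or (τ.2 0) with h | h
    · exact Or.inl (funext fun i => (h0 i).trans h)
    · exact Or.inr (funext fun i => (h0 i).trans h)
  · push Not at hs
    obtain ⟨a, ha⟩ := hs
    obtain ⟨l₀, l₃, h₀⟩ := exists_ofFn_eq_append (id : Fin (n + 1) → Fin (n + 1))
      (i := a.castSucc) (j := a.succ) (by simp)
    simp only [id] at h₀
    have hn₀ : (List.ofFn (id : Fin (n + 1) → Fin (n + 1))).Nodup :=
      List.nodup_ofFn.2 Function.injective_id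
    rw [h₀] at hn₀
    have := card_mixed_le hR hn₀ τ.2 ha (L := List.ofFn τ.1) (List.nodup_ofFn.2 τ.1.injective)
      (List.mem_ofFn.2 ⟨_, τ.1.apply_symm_apply _⟩)
      (List.mem_ofFn.2 ⟨_, τ.1.apply_symm_apply _⟩) g g
    rwa [Fintype.card_fin, ← h₀] at this

/-- The number of distinct rearrangements of a typical word with value `g` that also have
value `g`. -/
def symmetryBound (n R : ℕ) (g : G) : ℕ :=
  (if centCard g ≤ R then 1 else n + 1) * if g * g = 1 then 2 else 1

lemma symmetryBound_pos (R : ℕ) (g : G) : 0 < symmetryBound n R g := by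
  unfold symmetryBound
  split_ifs <;> simp

/-- The permutations left are dihedral, so the place of the letter 0 in the reading order and the
common sign determine them. A small centralizer forces place 0. -/
lemma card_le_symmetryBound (R : ℕ) (g : G) (y : Fin (n + 1) → G)
    (V : Finset (Equiv.Perm (Fin (n + 1)) × (Fin (n + 1) → ℤˣ)))
    (hV : ∀ τ ∈ V, signedVal y τ = g) (hE : ∀ τ ∈ V, ¬ IsExceptional R g τ) :
    V.card ≤ symmetryBound n R g := by
  have hdih : ∀ τ ∈ V, IsDihedral τ := fun τ hτ => by
    by_contra h; exact hE τ hτ (Or.inl h)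
  set A : Finset (Fin (n + 1)) := if centCard g ≤ R then {0} else Finset.univ with hA
  have hAcard : A.card = if centCard g ≤ R then 1 else n + 1 := by
    rw [hA]; split_ifs <;> simp
  have hpos : ∀ τ ∈ V, (readingOrder τ).symm 0 ∈ A := fun τ hτ => by
    rw [hA]
    split_ifs with h
    · rw [Finset.mem_singleton]
      by_contra h0; exact hE τ hτ (Or.inr ⟨h, h0⟩)
    · exact Finset.mem_univ _
  have hinj : ∀ τ ∈ V, ∀ τ' ∈ V, (readingOrder τ).symm 0 = (readingOrder τ').symm 0 →
      τ.2 = τ'.2 → τ = τ' := by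
    intro τ hτ τ' hτ' h h2
    have hr := (hdih τ hτ).2.ext (hdih τ' hτ').2 h
    refine Prod.ext ?_ h2
    unfold readingOrder at hr
    rw [h2] at hr
    split_ifs at hr with h1
    · exact hr
    · ext i
      have := Equiv.ext_iff.1 hr (Fin.rev i)
      simpa using congrArg Fin.val this
  have hsign : ∀ τ ∈ V, ∀ τ' ∈ V, τ.2 0 = τ'.2 0 → τ.2 = τ'.2 := by
    intro τ hτ τ' hτ' h
    rcases (hdih τ hτ).1 with h1 | h1 <;> rcases (hdih τ' hτ').1 with h2 | h2 <;>
      rw [h1, h2] at h ⊢ <;> simp at h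
  unfold symmetryBound
  rw [← hAcard]
  by_cases hg : g * g = 1
  · rw [if_pos hg]
    have h2 : (Finset.univ : Finset ℤˣ).card = 2 := rfl
    rw [← h2, ← Finset.card_product]
    refine Finset.card_le_card_of_injOn (fun τ => ((readingOrder τ).symm 0, τ.2 0))
      (fun τ hτ => ?_) fun τ hτ τ' hτ' h => ?_
    · exact Finset.mem_coe.2 (Finset.mem_product.2 ⟨hpos τ hτ, Finset.mem_univ _⟩)
    · simp only [Prod.mk.injEq] at h
      exact hinj τ hτ τ' hτ' h.1 (hsign τ hτ τ' hτ' h.2)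
  · rw [if_neg hg, mul_one]
    refine Finset.card_le_card_of_injOn (fun τ => (readingOrder τ).symm 0)
      (fun τ hτ => hpos τ hτ) fun τ hτ τ' hτ' h => ?_
    refine hinj τ hτ τ' hτ' h ?_
    have hr := (hdih τ hτ).2.ext (hdih τ' hτ').2 h
    -- The same reading order with both signs would give g = g⁻¹.
    have hne : ∀ ρ ∈ V, ∀ ρ' ∈ V, readingOrder ρ = readingOrder ρ' → ρ.2 = 1 → ρ'.2 ≠ -1 := by
      intro ρ hρ ρ' hρ' hr h1 h2
      have e1 := hV ρ hρ
      have e2 := hV ρ' hρ'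
      rw [signedVal_eq_of_eq_one y h1, hr] at e1
      rw [signedVal_eq_of_eq_neg_one y h2, e1] at e2
      exact hg (by nth_rewrite 1 [← e2]; simp)
    rcases (hdih τ hτ).1 with h1 | h1 <;> rcases (hdih τ' hτ').1 with h2 | h2
    · rw [h1, h2]
    · exact absurd h2 (hne τ hτ τ' hτ' hr h1)
    · exact absurd h1 (hne τ' hτ' τ hτ hr.symm h2)
    · rw [h1, h2]

end SignedPerm

/-! ### The sets of letters of typical words -/

section WordSets

variable {n : ℕ} {G : Type*} [Group G]

/-- The letters `y i ^ (e i)` of a signed word. -/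
def signedLetters (w : (Fin (n + 1) → G) × (Fin (n + 1) → ℤˣ)) (i : Fin (n + 1)) : G :=
  w.1 i ^ (w.2 i : ℤ)

lemma zpow_units_mul_self (x : G) (u : ℤˣ) : (x ^ (u : ℤ)) ^ (u : ℤ) = x := by
  rcases Int.units_eq_one_or u with rfl | rfl <;> simp

/-- Two signed words with the same letters are signed permutations of each other. -/
lemma exists_signedPerm [DecidableEq G] {w w' : (Fin (n + 1) → G) × (Fin (n + 1) → ℤˣ)}
    (hw' : Function.Injective (signedLetters w'))
    (h : Finset.univ.image (signedLetters w') = Finset.univ.image (signedLetters w)) :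
    ∃ τ : Equiv.Perm (Fin (n + 1)) × (Fin (n + 1) → ℤˣ),
      w' = (fun i => w.1 (τ.1 i) ^ (τ.2 (τ.1 i) : ℤ), fun i => τ.2 (τ.1 i) * w.2 (τ.1 i)) := by
  have h1 : ∀ i, ∃ j, signedLetters w j = signedLetters w' i := fun i => by
    have : signedLetters w' i ∈ Finset.univ.image (signedLetters w) := by
      rw [← h]; exact Finset.mem_image_of_mem _ (Finset.mem_univ _)
    simpa using this
  choose f hf using h1
  have hfi : Function.Injective f := fun i j hij => hw' (by rw [← hf i, ← hf j, hij])
  set π : Equiv.Perm (Fin (n + 1)) := Equiv.ofBijective f (Finite.injective_iff_bijective.1 hfi)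
  have hπ : ∀ i, π i = f i := fun i => rfl
  refine ⟨⟨π, fun j => w'.2 (π.symm j) * w.2 j⟩, Prod.ext ?_ ?_⟩
  · funext i
    simp only [π.symm_apply_apply, Units.val_mul]
    have h2 := hf i
    rw [← hπ] at h2
    unfold signedLetters at h2
    rw [mul_comm, zpow_mul, h2, zpow_units_mul_self]
  · funext i
    simp only [π.symm_apply_apply, mul_assoc, Int.units_mul_self, mul_one]

variable [Fintype G] [DecidableEq G]

open Classical in
/-- The signed words with value `g` and distinct letters, none of whose exceptional rearrangements
has value `g`. -/
noncomputable def typicalWords (n R : ℕ) (g : G) :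
    Finset ((Fin (n + 1) → G) × (Fin (n + 1) → ℤˣ)) :=
  Finset.univ.filter fun w => wordVal w.1 (List.ofFn id) = g ∧
    Function.Injective (signedLetters w) ∧
    ∀ τ, IsExceptional R g τ → signedVal w.1 τ ≠ g

/-- The sets of letters of typical words. -/
noncomputable def wordSets (n R : ℕ) (g : G) : Finset (Finset G) :=
  (typicalWords n R g).image fun w => Finset.univ.image (signedLetters w)

lemma mem_typicalWords {R : ℕ} {g : G} {w : (Fin (n + 1) → G) × (Fin (n + 1) → ℤˣ)} :
    w ∈ typicalWords n R g ↔ wordVal w.1 (List.ofFn id) = g ∧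
      Function.Injective (signedLetters w) ∧
      ∀ τ, IsExceptional R g τ → signedVal w.1 τ ≠ g := by
  simp [typicalWords]

lemma card_of_mem_wordSets {R : ℕ} {g : G} {A : Finset G} (hA : A ∈ wordSets n R g) :
    A.card = n + 1 := by
  obtain ⟨w, hw, rfl⟩ := Finset.mem_image.1 hA
  rw [Finset.card_image_of_injective _ (mem_typicalWords.1 hw).2.1, Finset.card_univ,
    Fintype.card_fin]

/-- Typical words with the letters of `w` come from signed permutations of `w` that preserve the
value g, and by typicality of `w` none of these is exceptional. -/
lemma card_typicalWords_le (R : ℕ) (g : G) :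
    (typicalWords n R g).card ≤ symmetryBound n R g * (wordSets n R g).card := by
  classical
  refine Finset.card_le_mul_card_image _ _ fun A hA => ?_
  obtain ⟨w, hw, rfl⟩ := Finset.mem_image.1 hA
  obtain ⟨-, -, hwe⟩ := mem_typicalWords.1 hw
  set V : Finset (Equiv.Perm (Fin (n + 1)) × (Fin (n + 1) → ℤˣ)) :=
    Finset.univ.filter fun τ => signedVal w.1 τ = g with hVdef
  have hV : V.card ≤ symmetryBound n R g :=
    card_le_symmetryBound R g w.1 V (fun τ hτ => (Finset.mem_filter.1 hτ).2)
      fun τ hτ he => hwe τ he (Finset.mem_filter.1 hτ).2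
  refine le_trans (Finset.card_le_card fun w' hw' => ?_) ((Finset.card_image_le
    (f := fun τ : Equiv.Perm (Fin (n + 1)) × (Fin (n + 1) → ℤˣ) =>
      ((fun i => w.1 (τ.1 i) ^ (τ.2 (τ.1 i) : ℤ), fun i => τ.2 (τ.1 i) * w.2 (τ.1 i)) :
        (Fin (n + 1) → G) × (Fin (n + 1) → ℤˣ)))).trans hV)
  obtain ⟨hw'1, hw'2⟩ := Finset.mem_filter.1 hw'
  obtain ⟨hg', hi', -⟩ := mem_typicalWords.1 hw'1
  obtain ⟨τ, hτ⟩ := exists_signedPerm hi' hw'2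
  refine Finset.mem_image.2 ⟨τ, Finset.mem_filter.2 ⟨Finset.mem_univ _, ?_⟩, hτ.symm⟩
  rw [← hg', hτ, signedVal, wordVal_ofFn, wordVal_ofFn]
  rfl

lemma card_wordVal_eq (g : G) :
    (Finset.univ.filter fun y : Fin (n + 1) → G => wordVal y (List.ofFn id) = g).card =
      Fintype.card G ^ n := by
  have h1 : Fintype.card G ^ n = (Finset.univ : Finset (Fin n → G)).card := by simp
  rw [h1]
  refine Finset.card_bij' (fun y _ => Fin.tail y)
    (fun z _ => Fin.cons (g * (List.ofFn z).prod⁻¹) z) (fun _ _ => Finset.mem_univ _)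
    (fun z _ => ?_) (fun y hy => ?_) (fun z _ => ?_)
  · simp [wordVal_ofFn, List.ofFn_succ]
  · have hy' := (Finset.mem_filter.1 hy).2
    rw [wordVal_ofFn, List.ofFn_succ, List.prod_cons] at hy'
    funext i
    refine Fin.cases ?_ (fun j => ?_) i
    · rw [Fin.cons_zero, ← hy']
      exact mul_inv_cancel_right _ _
    · rw [Fin.cons_succ]; rfl
  · simp

/-- Coincidences between letters. With three or more letters, the coincidence fixes one letter and
the word equation another. With two, y₀² = g is a square root equation and y₀y₀⁻¹ = g is excluded by
`hg`. -/
lemma card_eq_zpow_le {R : ℕ} (hR : commPairs G ≤ R ^ 2) {g : G} (hg : g ≠ 1) (hn : 1 ≤ n)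
    {i j : Fin (n + 1)} (hij : i < j) (u : ℤˣ) :
    (Finset.univ.filter fun y : Fin (n + 1) → G => wordVal y (List.ofFn id) = g ∧
      y j = y i ^ (u : ℤ)).card ≤ Fintype.card G ^ (n + 1 - 2) * R := by
  have hR0 : 1 ≤ R := by
    have h1 := Fintype.card_pos (α := G)
    have h2 := card_le_commPairs (G := G)
    by_contra h
    obtain rfl : R = 0 := by omega
    simp at hR
    omega
  by_cases hn2 : 2 ≤ n
  · obtain ⟨c, hc⟩ : ∃ c : Fin (n + 1), c ∉ ({i, j} : Finset (Fin (n + 1))) := by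
      by_contra! h
      have := Finset.card_le_card (fun c _ => h c : Finset.univ ⊆ ({i, j} : Finset (Fin (n + 1))))
      have h2 := Finset.card_le_two (a := i) (b := j)
      simp only [Finset.card_univ, Fintype.card_fin] at this
      omega
    simp only [Finset.mem_insert, Finset.mem_singleton, not_or] at hc
    have hcard : ({c, j} : Finset (Fin (n + 1))).card = 2 := Finset.card_pair hc.2
    have := card_le_of_fiber_le (T := Finset.univ.filter fun y : Fin (n + 1) → G =>
      wordVal y (List.ofFn id) = g ∧ y j = y i ^ (u : ℤ)) {c, j} (B := 1) fun y₀ => by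
        refine Finset.card_le_one.2 fun y hy y' hy' => ?_
        simp only [Finset.mem_filter, Finset.mem_univ, true_and, Finset.mem_insert,
          Finset.mem_singleton, not_or, and_imp] at hy hy'
        have hj : y j = y' j := by
          rw [hy.1.2, hy'.1.2, hy.2 i (Ne.symm hc.1) hij.ne, hy'.2 i (Ne.symm hc.1) hij.ne]
        have hne : ∀ k, k ≠ c → y k = y' k := fun k hk => by
          by_cases hkj : k = j
          · rw [hkj, hj]
          · rw [hy.2 k hk hkj, hy'.2 k hk hkj]
        have hu : y' = Function.update y c (y' c) := by
          funext k
          by_cases hk : k = c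
          · subst hk; simp
          · rw [Function.update_of_ne hk, hne k hk]
        have hinj := wordVal_update_injective y (c := c) (l := List.ofFn id)
          (List.nodup_ofFn.2 Function.injective_id) (List.mem_ofFn.2 ⟨c, rfl⟩)
        have hv : y c = y' c := hinj (by
          dsimp only
          rw [Function.update_eq_self, ← hu, hy.1.1, hy'.1.1])
        rw [hu, ← hv, Function.update_eq_self]
    rw [hcard, Fintype.card_fin, mul_one] at this
    exact this.trans (Nat.le_mul_of_pos_right _ hR0)
  · obtain rfl : n = 1 := by omega
    obtain rfl : i = 0 := by ext; have := j.isLt; rw [Fin.lt_def] at hij; simp; omega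
    obtain rfl : j = 1 := by ext; have := j.isLt; rw [Fin.lt_def] at hij; simp at hij ⊢; omega
    rw [show 1 + 1 - 2 = 0 by rfl, pow_zero, one_mul]
    rcases Int.units_eq_one_or u with rfl | rfl
    · refine le_trans (Finset.card_le_card_of_injOn (fun y => y 0) (fun y hy => ?_) ?_)
        (card_sandwich_sq_le hR 1 1 1 g)
      · simp only [Finset.coe_filter, Finset.mem_univ, true_and, wordVal_ofFn, Set.mem_ofPred_eq,
          Units.val_one, zpow_one] at hy ⊢
        rw [← hy.1]
        simp [List.ofFn_succ, hy.2]
      · intro y hy y' hy' h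
        simp only [Finset.coe_filter, Finset.mem_univ, true_and, Set.mem_ofPred_eq,
          Units.val_one, zpow_one] at hy hy' h
        funext k
        fin_cases k
        · exact h
        · exact (hy.2.trans h).trans hy'.2.symm
    · rw [Finset.card_eq_zero.2 (Finset.filter_eq_empty_iff.2 fun y _ hy => hg ?_)]
      · exact Nat.zero_le _
      · rw [← hy.1, wordVal_ofFn]
        simp [List.ofFn_succ, hy.2]

/-- Remove from the words of value g those fixed by one of at most 2^d d! exceptional signed
permutations (`X`) and those with one of at most 2d² coincidences (`Y`). Every choice of signs on
the remaining words is typical. -/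
lemma card_typicalWords_ge {R : ℕ} (hR : commPairs G ≤ R ^ 2)
    (hR' : commPairs G ≤ Fintype.card G * R) {g : G} (hg : g ≠ 1) (hn : 1 ≤ n) :
    2 ^ (n + 1) * Fintype.card G ^ n ≤ (typicalWords n R g).card +
      2 ^ (n + 1) * ((2 ^ (n + 1) * (n + 1).factorial + 2 * (n + 1) ^ 2) *
        (Fintype.card G ^ (n - 1) * R)) := by
  classical
  have hsub : n + 1 - 2 = n - 1 := by omega
  set E := Finset.univ.filter fun y : Fin (n + 1) → G => wordVal y (List.ofFn id) = g with hE
  set X : Finset (Fin (n + 1) → G) := (Finset.univ.filter fun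
    τ : Equiv.Perm (Fin (n + 1)) × (Fin (n + 1) → ℤˣ) => IsExceptional R g τ).biUnion fun τ =>
      Finset.univ.filter fun y : Fin (n + 1) → G => wordVal y (List.ofFn id) = g ∧
        signedVal y τ = g with hX
  set Y : Finset (Fin (n + 1) → G) := (Finset.univ.filter fun
    t : (Fin (n + 1) × Fin (n + 1)) × ℤˣ => t.1.1 < t.1.2).biUnion fun t =>
      Finset.univ.filter fun y : Fin (n + 1) → G => wordVal y (List.ofFn id) = g ∧
        y t.1.2 = y t.1.1 ^ (t.2 : ℤ) with hY
  have hunits : Fintype.card ℤˣ = 2 := rfl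
  have hXc : X.card ≤ 2 ^ (n + 1) * (n + 1).factorial * (Fintype.card G ^ (n - 1) * R) := by
    refine (Finset.card_biUnion_le_card_mul _ _ (Fintype.card G ^ (n - 1) * R)
      fun τ hτ => ?_).trans (Nat.mul_le_mul_right _ ?_)
    · rw [← hsub]; exact card_isExceptional_le hR hR' g (Finset.mem_filter.1 hτ).2
    · refine (Finset.card_le_univ _).trans (le_of_eq ?_)
      rw [Fintype.card_prod, Fintype.card_perm, Fintype.card_fun, hunits, Fintype.card_fin,
        mul_comm]
  have hYc : Y.card ≤ 2 * (n + 1) ^ 2 * (Fintype.card G ^ (n - 1) * R) := by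
    refine (Finset.card_biUnion_le_card_mul _ _ (Fintype.card G ^ (n - 1) * R)
      fun t ht => ?_).trans (Nat.mul_le_mul_right _ ?_)
    · rw [← hsub]; exact card_eq_zpow_le hR hg hn (Finset.mem_filter.1 ht).2 t.2
    · refine (Finset.card_le_univ _).trans (le_of_eq ?_)
      rw [Fintype.card_prod, Fintype.card_prod, hunits, Fintype.card_fin]
      ring
  have hsubset : (E \ (X ∪ Y)) ×ˢ (Finset.univ : Finset (Fin (n + 1) → ℤˣ)) ⊆
      typicalWords n R g := by
    rintro ⟨y, e⟩ hye
    obtain ⟨hy, hxy⟩ := Finset.mem_sdiff.1 (Finset.mem_product.1 hye).1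
    have hyg := (Finset.mem_filter.1 hy).2
    rw [Finset.mem_union, not_or] at hxy
    refine mem_typicalWords.2 ⟨hyg, ?_, fun τ hτ hv => hxy.1 ?_⟩
    · have key : ∀ i j : Fin (n + 1), i < j →
          signedLetters (y, e) i ≠ signedLetters (y, e) j := by
        intro i j hij h
        refine hxy.2 (Finset.mem_biUnion.2 ⟨((i, j), e i * e j), by simpa using hij, ?_⟩)
        refine Finset.mem_filter.2 ⟨Finset.mem_univ _, hyg, ?_⟩
        simp only [signedLetters] at h
        rw [Units.val_mul, zpow_mul, h, zpow_units_mul_self]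
      intro i j h
      by_contra hne
      rcases lt_or_gt_of_ne hne with h' | h'
      · exact key i j h' h
      · exact key j i h' h.symm
    · exact Finset.mem_biUnion.2 ⟨τ, by simpa using hτ, Finset.mem_filter.2
        ⟨Finset.mem_univ _, hyg, hv⟩⟩
  have h1 := Finset.card_le_card hsubset
  rw [Finset.card_product, Finset.card_univ, Fintype.card_fun, hunits, Fintype.card_fin] at h1
  have h2 := Finset.le_card_sdiff (X ∪ Y) E
  have h3 := Finset.card_union_le X Y
  have h4 : E.card = Fintype.card G ^ n := card_wordVal_eq g
  have h5 : Fintype.card G ^ n ≤ (E \ (X ∪ Y)).card +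
      (2 ^ (n + 1) * (n + 1).factorial + 2 * (n + 1) ^ 2) * (Fintype.card G ^ (n - 1) * R) := by
    rw [add_mul]; omega
  calc _ ≤ 2 ^ (n + 1) * ((E \ (X ∪ Y)).card +
      (2 ^ (n + 1) * (n + 1).factorial + 2 * (n + 1) ^ 2) * (Fintype.card G ^ (n - 1) * R)) :=
        Nat.mul_le_mul_left _ h5
    _ ≤ _ := by rw [mul_add, mul_comm _ (E \ (X ∪ Y)).card]; omega

/-- The number of signed words with value `g` whose letters at the positions in `P` belong
to `A`. -/
lemma card_letters_mem_le {g : G} {A : Finset G} {P : Finset (Fin (n + 1))}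
    (hP : P ≠ Finset.univ) :
    (Finset.univ.filter fun w : (Fin (n + 1) → G) × (Fin (n + 1) → ℤˣ) =>
      wordVal w.1 (List.ofFn id) = g ∧ ∀ i ∈ P, signedLetters w i ∈ A).card ≤
      2 ^ (n + 1) * (A.card ^ P.card * Fintype.card G ^ (n - P.card)) := by
  classical
  obtain ⟨c, hc⟩ : ∃ c, c ∉ P := by
    by_contra! h; exact hP (Finset.eq_univ_iff_forall.2 h)
  have h2 : 2 ^ (n + 1) = (Finset.univ : Finset (Fin (n + 1) → ℤˣ)).card := by
    rw [Finset.card_univ, Fintype.card_fun, Fintype.card_fin]; rfl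
  rw [mul_comm, h2]
  refine Finset.card_le_mul_card_image_of_maps_to (f := Prod.snd) (fun _ _ => Finset.mem_univ _) _
    fun e _ => ?_
  -- The letter at `c ∉ P` is determined by the others through the word equation, so it is
  -- overwritten by 1 and contributes no factor.
  set B : Fin (n + 1) → Finset G := fun i =>
    if i = c then {1} else if i ∈ P then A.image fun x => x ^ (e i : ℤ) else Finset.univ with hB
  have h3 : (Fintype.piFinset B).card ≤ A.card ^ P.card * Fintype.card G ^ (n - P.card) := by
    rw [Fintype.card_piFinset, ← Finset.mul_prod_erase _ _ (Finset.mem_univ c)]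
    have hBc : (B c).card = 1 := by simp [hB]
    rw [hBc, one_mul]
    calc ∏ i ∈ Finset.univ.erase c, (B i).card
        ≤ ∏ i ∈ Finset.univ.erase c, if i ∈ P then A.card else Fintype.card G := by
          refine Finset.prod_le_prod' fun i hi => ?_
          simp only [hB, if_neg (Finset.ne_of_mem_erase hi)]
          split_ifs
          · exact Finset.card_image_le
          · exact le_rfl
      _ = _ := by
          have hPs : P ⊆ Finset.univ.erase c := fun i hi =>
            Finset.mem_erase.2 ⟨fun h => hc (h ▸ hi), Finset.mem_univ _⟩
          rw [Finset.prod_ite, Finset.prod_const, Finset.prod_const, Finset.filter_mem_eq_inter,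
            Finset.inter_eq_right.2 hPs, Finset.filter_notMem_eq_sdiff,
            Finset.card_sdiff_of_subset hPs, Finset.card_erase_of_mem (Finset.mem_univ _),
            Finset.card_univ, Fintype.card_fin, Nat.add_sub_cancel]
  refine le_trans ?_ h3
  refine Finset.card_le_card_of_injOn (fun w => Function.update w.1 c 1) (fun w hw => ?_) ?_
  · simp only [Finset.coe_filter, Finset.mem_filter, Finset.mem_univ, true_and,
      Set.mem_ofPred_eq] at hw
    rw [Finset.mem_coe, Fintype.mem_piFinset]
    intro i
    by_cases hic : i = c
    · subst hic; simp [hB]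
    · dsimp only
      rw [Function.update_of_ne hic]
      simp only [hB, if_neg hic]
      split_ifs with hi
      · refine Finset.mem_image.2 ⟨_, hw.1.2 i hi, ?_⟩
        rw [← hw.2, signedLetters, zpow_units_mul_self]
      · exact Finset.mem_univ _
  · intro w hw w' hw' h
    simp only [Finset.coe_filter, Finset.mem_filter, Finset.mem_univ, true_and,
      Set.mem_ofPred_eq] at hw hw' h
    refine Prod.ext ?_ (hw.2.trans hw'.2.symm)
    have hu : w'.1 = Function.update w.1 c (w'.1 c) := by
      have := congrArg (fun y => Function.update y c (w'.1 c)) h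
      simpa using this.symm
    have hinj := wordVal_update_injective w.1 (c := c) (l := List.ofFn id)
      (List.nodup_ofFn.2 Function.injective_id) (List.mem_ofFn.2 ⟨c, rfl⟩)
    have hv : w.1 c = w'.1 c := hinj (by
      dsimp only
      rw [Function.update_eq_self, ← hu, hw.1.1, hw'.1.1])
    rw [hu, ← hv, Function.update_eq_self]

lemma card_wordSets_le (R : ℕ) (g : G) :
    (wordSets n R g).card ≤ 2 ^ (n + 1) * Fintype.card G ^ n := by
  have h := card_letters_mem_le (n := n) (g := g) (A := ∅) (P := ∅)
    (Finset.univ_nonempty.ne_empty.symm)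
  simp only [Finset.card_empty, pow_zero, one_mul, Nat.sub_zero] at h
  refine (Finset.card_image_le.trans (Finset.card_le_card fun w hw => ?_)).trans h
  simpa using (mem_typicalWords.1 hw).1

lemma card_wordSets_inter_le (R : ℕ) (g : G) {A : Finset G} (hA : A.card = n + 1) {k : ℕ}
    (hk : k ≤ n) :
    ((wordSets n R g).filter fun B => (A ∩ B).card = k).card ≤
      (n + 1).choose k * (2 ^ (n + 1) * ((n + 1) ^ k * Fintype.card G ^ (n - k))) := by
  classical
  set W : Finset (Fin (n + 1)) → Finset ((Fin (n + 1) → G) × (Fin (n + 1) → ℤˣ)) := fun P =>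
    Finset.univ.filter fun w => wordVal w.1 (List.ofFn id) = g ∧ ∀ i ∈ P, signedLetters w i ∈ A
  have h1 : ((wordSets n R g).filter fun B => (A ∩ B).card = k) ⊆
      ((Finset.powersetCard k Finset.univ).biUnion W).image
        fun w => Finset.univ.image (signedLetters w) := by
    intro B hB
    obtain ⟨hB1, hB2⟩ := Finset.mem_filter.1 hB
    obtain ⟨w, hw, rfl⟩ := Finset.mem_image.1 hB1
    obtain ⟨hwg, hwi, -⟩ := mem_typicalWords.1 hw
    refine Finset.mem_image.2 ⟨w, Finset.mem_biUnion.2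
      ⟨Finset.univ.filter fun i => signedLetters w i ∈ A, ?_, ?_⟩, rfl⟩
    · rw [Finset.mem_powersetCard]
      refine ⟨Finset.subset_univ _, ?_⟩
      rw [← hB2, ← Finset.card_image_of_injective _ hwi]
      congr 1
      ext x
      simp only [Finset.mem_image, Finset.mem_filter, Finset.mem_univ, true_and, Finset.mem_inter]
      constructor
      · rintro ⟨i, hi, rfl⟩; exact ⟨hi, i, rfl⟩
      · rintro ⟨hx, i, rfl⟩; exact ⟨i, hx, rfl⟩
    · exact Finset.mem_filter.2 ⟨Finset.mem_univ _, hwg, fun i hi => (Finset.mem_filter.1 hi).2⟩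
  refine (Finset.card_le_card h1).trans (Finset.card_image_le.trans ?_)
  refine (Finset.card_biUnion_le_card_mul _ _ (2 ^ (n + 1) * ((n + 1) ^ k *
    Fintype.card G ^ (n - k))) fun P hP => ?_).trans (le_of_eq ?_)
  · rw [Finset.mem_powersetCard] at hP
    have := card_letters_mem_le (g := g) (A := A) (P := P) (by
      rintro rfl
      rw [Finset.card_univ, Fintype.card_fin] at hP
      omega)
    rwa [hA, hP.2] at this
  · rw [Finset.card_powersetCard, Finset.card_univ, Fintype.card_fin]

end WordSets

/-! ### The diameter of a random Cayley graph -/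

open MeasureTheory in
lemma setBernoulli_real_eq {α : Type*} [Fintype α] [DecidableEq α] (p : I) (E : Set (Set α))
    [DecidablePred (· ∈ E)] :
    (ProbabilityTheory.setBernoulli (Set.univ : Set α) p).real E =
      bernoulliExp p Finset.univ (fun S : Finset α => if (S : Set α) ∈ E then 1 else 0) := by
  have h1 : E = ⋃ (S : Finset α) (_ : S ∈ Finset.univ.filter fun S : Finset α => (S : Set α) ∈ E),
      {(S : Set α)} := by
    ext S
    simp only [Set.mem_iUnion, Finset.mem_filter, Finset.mem_univ, true_and, Set.mem_singleton_iff,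
      exists_prop]
    constructor
    · intro hS
      refine ⟨S.toFinite.toFinset, ?_, ?_⟩ <;> simp [hS]
    · rintro ⟨T, hT, rfl⟩; exact hT
  conv_lhs => rw [h1]
  rw [measureReal_biUnion_finset (by
    intro S _ T _ hST
    simpa [Function.onFun] using hST) (fun _ _ => MeasurableSet.singleton _)]
  rw [bernoulliExp, Finset.powerset_univ, Finset.sum_filter]
  refine Finset.sum_congr rfl fun S _ => ?_
  rw [ProbabilityTheory.setBernoulli_real_singleton p (Set.subset_univ _) Set.finite_univ]
  have h2 : (Set.univ \ (S : Set α)).ncard = (Finset.univ \ S).card := by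
    rw [← Set.ncard_coe_finset]; simp
  rw [h2, Set.ncard_coe_finset, mul_ite, mul_one, mul_zero]

section Diameter

variable {G : Type*} [Group G]

lemma cayleyGraph_edist_mul_le_one (S : Set G) (u : G) {x : G} (hx : x ∈ S ∨ x⁻¹ ∈ S) :
    (cayleyGraph S).edist u (u * x) ≤ 1 := by
  by_cases h : x = 1
  · subst h; simp
  · refine le_of_eq (SimpleGraph.edist_eq_one_iff_adj.2 ?_)
    rw [cayleyGraph, SimpleGraph.fromRel_adj]
    refine ⟨fun h' => h (by simpa using h'.symm), ?_⟩
    rcases hx with hx | hx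
    · left; simpa using hx
    · right; simpa using hx

lemma cayleyGraph_edist_mul_prod_le (S : Set G) (l : List G) (hl : ∀ x ∈ l, x ∈ S ∨ x⁻¹ ∈ S)
    (u : G) : (cayleyGraph S).edist u (u * l.prod) ≤ l.length := by
  induction l generalizing u with
  | nil => simp
  | cons x l ih =>
    have h1 := cayleyGraph_edist_mul_le_one S u (hl x List.mem_cons_self)
    have h2 := ih (fun z hz => hl z (List.mem_cons_of_mem _ hz)) (u * x)
    rw [List.prod_cons, ← mul_assoc, List.length_cons, Nat.cast_add, Nat.cast_one, add_comm]
    exact (SimpleGraph.edist_triangle).trans (add_le_add h1 h2)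

variable [Fintype G] [DecidableEq G]

lemma cayleyGraph_ediam_le {n R : ℕ} (S : Set G)
    (h : ∀ g : G, g ≠ 1 → ∃ A ∈ wordSets n R g, (A : Set G) ⊆ S) :
    (cayleyGraph S).ediam ≤ ((n + 1 : ℕ) : ℕ∞) := by
  refine SimpleGraph.ediam_le_of_edist_le fun u v => ?_
  by_cases huv : u⁻¹ * v = 1
  · rw [inv_mul_eq_one.1 huv]; simp
  · obtain ⟨A, hA, hAS⟩ := h _ huv
    obtain ⟨w, hw, rfl⟩ := Finset.mem_image.1 hA
    have hwg := (mem_typicalWords.1 hw).1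
    have hv : v = u * (List.ofFn w.1).prod := by
      rw [wordVal_ofFn] at hwg
      simp only [id] at hwg
      rw [hwg]; group
    have hlen : (List.ofFn w.1).length = n + 1 := List.length_ofFn
    rw [hv]
    refine (cayleyGraph_edist_mul_prod_le S _ (fun x hx => ?_) u).trans_eq (by rw [hlen])
    obtain ⟨i, rfl⟩ := List.mem_ofFn.1 hx
    have hi : signedLetters w i ∈ S := hAS (by simp)
    unfold signedLetters at hi
    rcases Int.units_eq_one_or (w.2 i) with h1 | h1
    · left; simpa [h1] using hi
    · right; simpa [h1] using hi

/-- By left translation one event for each g = u⁻¹v suffices, so the union bound has fewer than |G|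
terms rather than one for each pair. -/
lemma one_sub_sum_le_probDiamLE (n R : ℕ) (p : I) :
    1 - ∑ g ∈ Finset.univ.erase (1 : G),
      bernoulliExp (p : ℝ) Finset.univ (avoidInd (wordSets n R g)) ≤ probDiamLE G p (n + 1) := by
  classical
  rw [probDiamLE, setBernoulli_real_eq]
  suffices h : bernoulliExp (p : ℝ) (Finset.univ : Finset G) (fun S =>
      1 - ∑ g ∈ Finset.univ.erase (1 : G), avoidInd (wordSets n R g) S) ≤ _ by
    rwa [bernoulliExp.sub, bernoulliExp.one, bernoulliExp.sum] at h
  refine bernoulliExp.mono p.2.1 p.2.2 fun S => ?_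
  simp only [Set.mem_ofPred_eq]
  split_ifs with h
  · have : 0 ≤ ∑ g ∈ Finset.univ.erase (1 : G), avoidInd (wordSets n R g) S :=
      Finset.sum_nonneg fun g _ => avoidInd_nonneg _ _
    linarith
  · by_contra hc
    refine h (cayleyGraph_ediam_le (R := R) _ fun g hg => ?_)
    by_contra hg'
    push Not at hg'
    have h1 : avoidInd (wordSets n R g) S = 1 := by
      rw [avoidInd, if_pos fun A hA hAS => hg' A hA (by exact_mod_cast hAS)]
    have h2 := Finset.single_le_sum (f := fun g => avoidInd (wordSets n R g) S)
      (fun g _ => avoidInd_nonneg _ _) (Finset.mem_erase.2 ⟨hg, Finset.mem_univ _⟩)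
    linarith

/-- The correlation term in Janson's inequality for the sets of letters of typical words. -/
lemma sum_correlation_le {n R : ℕ} (g : G) {p t lam : ℝ} (hp : 0 < p)
    (ht : t = (n + 1) / (Fintype.card G * p))
    (hlam : lam = 2 ^ (n + 1) * (Fintype.card G : ℝ) ^ n * p ^ (n + 1)) :
    ∑ A ∈ wordSets n R g, ∑ B ∈ wordSets n R g with B ≠ A ∧ ¬ Disjoint A B, p ^ (A ∪ B).card ≤
      lam ^ 2 * ((1 + t) ^ (n + 1) - 1) := by
  set N : ℝ := (Fintype.card G : ℝ) with hN
  have hN0 : 0 < N := by rw [hN]; exact_mod_cast Fintype.card_pos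
  have ht0 : 0 ≤ t := by rw [ht]; positivity
  have hlam0 : 0 ≤ lam := by rw [hlam]; positivity
  have h1 : ∀ A ∈ wordSets n R g,
      ∑ B ∈ wordSets n R g with B ≠ A ∧ ¬ Disjoint A B, p ^ (A ∪ B).card ≤
        p ^ (n + 1) * lam * ((1 + t) ^ (n + 1) - 1) := by
    intro A hA
    have hAc := card_of_mem_wordSets hA
    have h2 : ∀ B ∈ (wordSets n R g).filter fun B => B ≠ A ∧ ¬ Disjoint A B,
        (A ∩ B).card ∈ Finset.Icc 1 n := by
      intro B hB
      obtain ⟨hB1, hB2, hB3⟩ := Finset.mem_filter.1 hB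
      have hBc := card_of_mem_wordSets hB1
      rw [Finset.mem_Icc]
      constructor
      · exact Finset.card_pos.2 (Finset.not_disjoint_iff_nonempty_inter.1 hB3)
      · by_contra hlt
        push Not at hlt
        have hAB : A ∩ B = A := Finset.eq_of_subset_of_card_le Finset.inter_subset_left (by omega)
        have hBA : A ∩ B = B := Finset.eq_of_subset_of_card_le Finset.inter_subset_right (by omega)
        exact hB2 (hBA.symm.trans hAB)
    rw [← Finset.sum_fiberwise_of_maps_to h2]
    have h3 : ∀ k ∈ Finset.Icc 1 n,
        ∑ B ∈ ((wordSets n R g).filter fun B => B ≠ A ∧ ¬ Disjoint A B) with (A ∩ B).card = k,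
          p ^ (A ∪ B).card ≤ p ^ (n + 1) * lam * (t ^ k * (n + 1).choose k) := by
      intro k hk
      obtain ⟨hk1, hkn⟩ := Finset.mem_Icc.1 hk
      have h4 : ∀ B ∈ ((wordSets n R g).filter fun B => B ≠ A ∧ ¬ Disjoint A B).filter
          fun B => (A ∩ B).card = k, p ^ (A ∪ B).card = p ^ (2 * (n + 1) - k) := by
        intro B hB
        obtain ⟨hB1, hB2⟩ := Finset.mem_filter.1 hB
        have hBc := card_of_mem_wordSets (Finset.mem_filter.1 hB1).1
        have := Finset.card_union_add_card_inter A B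
        congr 1
        omega
      rw [Finset.sum_congr rfl h4, Finset.sum_const, nsmul_eq_mul]
      have h5 : ((((wordSets n R g).filter fun B => B ≠ A ∧ ¬ Disjoint A B).filter
          fun B => (A ∩ B).card = k).card : ℝ) ≤
          (n + 1).choose k * (2 ^ (n + 1) * ((n + 1 : ℝ) ^ k * N ^ (n - k))) := by
        have := (Finset.card_le_card (Finset.filter_subset_filter _
          (Finset.filter_subset (fun B => B ≠ A ∧ ¬ Disjoint A B) _))).trans
          (card_wordSets_inter_le R g hAc hkn)
        rw [hN]
        exact_mod_cast this
      refine (mul_le_mul_of_nonneg_right h5 (by positivity)).trans (le_of_eq ?_)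
      obtain ⟨j, rfl⟩ : ∃ j, n = k + j := ⟨n - k, by omega⟩
      rw [show k + j - k = j by omega, show 2 * (k + j + 1) - k = k + j + 1 + (j + 1) by omega,
        hlam, ht, div_pow, mul_pow]
      rw [pow_add p (k + j + 1) (j + 1), pow_add p (k + j) 1, pow_add p k j, pow_add N k j]
      push_cast
      field_simp
      ring
    refine (Finset.sum_le_sum h3).trans ?_
    rw [← Finset.mul_sum]
    refine mul_le_mul_of_nonneg_left ?_ (by positivity)
    -- The intersection sizes 1, …, n are the binomial terms other than k = 0, which is the
    -- subtracted 1, and k = n + 1, which is dropped.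
    have h6 : (1 + t) ^ (n + 1) = ∑ k ∈ Finset.range (n + 2), t ^ k * ((n + 1).choose k : ℝ) := by
      rw [add_comm, add_pow]
      simp
    rw [h6, Finset.sum_range_succ, Finset.sum_range_eq_add_Ico _ (by omega : 0 < n + 1)]
    have h7 : Finset.Icc 1 n = Finset.Ico 1 (n + 1) := by ext; simp
    have h8 : 0 ≤ t ^ (n + 1) * ((n + 1).choose (n + 1) : ℝ) := by positivity
    rw [h7]
    simp only [pow_zero, Nat.choose_zero_right, Nat.cast_one, mul_one]
    linarith
  refine (Finset.sum_le_sum h1).trans ?_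
  rw [Finset.sum_const, nsmul_eq_mul]
  have h9 : ((wordSets n R g).card : ℝ) * p ^ (n + 1) ≤ lam := by
    rw [hlam]
    refine mul_le_mul_of_nonneg_right ?_ (by positivity)
    rw [hN]; exact_mod_cast card_wordSets_le R g
  have h10 : 0 ≤ (1 + t) ^ (n + 1) - 1 := sub_nonneg.2 (one_le_pow₀ (by linarith))
  calc _ = ((wordSets n R g).card : ℝ) * p ^ (n + 1) * (lam * ((1 + t) ^ (n + 1) - 1)) := by ring
    _ ≤ lam * (lam * ((1 + t) ^ (n + 1) - 1)) :=
        mul_le_mul_of_nonneg_right h9 (mul_nonneg hlam0 h10)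
    _ = _ := by ring

/-- The expected number of sets of letters of typical words in a random set. -/
lemma le_symmetryBound_mul_sum {n R : ℕ} (hR : commPairs G ≤ R ^ 2)
    (hR' : commPairs G ≤ Fintype.card G * R) {g : G} (hg : g ≠ 1) (hn : 1 ≤ n) {p lam : ℝ}
    (hp : 0 < p) (hlam : lam = 2 ^ (n + 1) * (Fintype.card G : ℝ) ^ n * p ^ (n + 1)) :
    lam * (1 - (2 ^ (n + 1) * (n + 1).factorial + 2 * (n + 1) ^ 2) * (R / Fintype.card G)) ≤
      symmetryBound n R g * ∑ A ∈ wordSets n R g, p ^ A.card := by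
  set N : ℝ := (Fintype.card G : ℝ) with hN
  have hN0 : 0 < N := by rw [hN]; exact_mod_cast Fintype.card_pos
  rw [Finset.sum_congr rfl fun A hA => by rw [card_of_mem_wordSets hA], Finset.sum_const,
    nsmul_eq_mul]
  have h1 : (2 : ℝ) ^ (n + 1) * N ^ n ≤ (typicalWords n R g).card +
      2 ^ (n + 1) * ((2 ^ (n + 1) * (n + 1).factorial + 2 * (n + 1) ^ 2) * (N ^ (n - 1) * R)) := by
    rw [hN]; exact_mod_cast card_typicalWords_ge hR hR' hg hn
  have h2 : ((typicalWords n R g).card : ℝ) ≤ symmetryBound n R g * (wordSets n R g).card := by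
    exact_mod_cast card_typicalWords_le R g
  have h3 : N ^ (n - 1) * R = N ^ n * (R / N) := by
    obtain ⟨k, rfl⟩ : ∃ k, n = k + 1 := ⟨n - 1, by omega⟩
    rw [Nat.add_sub_cancel, pow_succ]
    field_simp
  rw [h3] at h1
  have hp' : 0 ≤ p ^ (n + 1) := by positivity
  calc _ = (2 ^ (n + 1) * N ^ n - 2 ^ (n + 1) *
        ((2 ^ (n + 1) * (n + 1).factorial + 2 * (n + 1) ^ 2) * (N ^ n * (R / N)))) *
          p ^ (n + 1) := by rw [hlam]; ring
    _ ≤ (symmetryBound n R g * (wordSets n R g).card) * p ^ (n + 1) :=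
        mul_le_mul_of_nonneg_right (by linarith) hp'
    _ = _ := by ring

end Diameter

/-! ### Asymptotic estimates -/

section Asymptotics

open Filter Real

/-- All bounds are in terms of log N alone, which makes the final estimate uniform in d, G and p. -/
lemma eventually_log_large (ε η : ℝ) (hε : 0 < ε) (hη : 0 < η) :
    ∃ N₀ : ℕ, ∀ N : ℕ, N₀ ≤ N → 2 ≤ log (log N) ∧ 16 * log (log N) ≤ log N ∧
      4 * log N ^ 3 ≤ exp (√(log N)) ∧ 64 ≤ ε * exp (√(log N) / 2) ∧
      12 * exp (-(ε / 8 * √(log N))) ≤ η := by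
  have hN : Tendsto (fun N : ℕ => log (N : ℝ)) atTop atTop :=
    tendsto_log_atTop.comp tendsto_natCast_atTop_atTop
  have h1 : ∀ᶠ x : ℝ in atTop, 2 ≤ log x := tendsto_log_atTop.eventually_ge_atTop 2
  have h2 : ∀ᶠ x : ℝ in atTop, 16 * log x ≤ x := by
    have := isLittleO_log_id_atTop.bound (c := 1 / 16) (by norm_num)
    filter_upwards [this, eventually_ge_atTop 0] with x hx hx0
    simp only [id, norm_eq_abs] at hx
    rw [abs_of_nonneg hx0] at hx
    have := le_abs_self (log x)
    linarith
  have h3 : ∀ᶠ x : ℝ in atTop, 4 * x ^ 3 ≤ exp (√x) := by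
    have h := (tendsto_pow_mul_exp_neg_atTop_nhds_zero 6).comp tendsto_sqrt_atTop
    have h' := h.eventually (gt_mem_nhds (by norm_num : (0 : ℝ) < 1 / 4))
    filter_upwards [h', eventually_ge_atTop 0] with x hx hx0
    simp only [Function.comp_apply] at hx
    have e : √x ^ 6 = x ^ 3 := by
      rw [show 6 = 2 * 3 by norm_num, pow_mul, sq_sqrt hx0]
    rw [e, exp_neg, ← div_eq_mul_inv, div_lt_iff₀ (exp_pos _)] at hx
    linarith
  have h4 : ∀ᶠ x : ℝ in atTop, 64 ≤ ε * exp (√x / 2) := by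
    have h : Tendsto (fun x : ℝ => ε * exp (√x / 2)) atTop atTop :=
      (tendsto_exp_atTop.comp (tendsto_sqrt_atTop.atTop_div_const two_pos)).const_mul_atTop hε
    exact h.eventually_ge_atTop 64
  have h5 : ∀ᶠ x : ℝ in atTop, 12 * exp (-(ε / 8 * √x)) ≤ η := by
    have h : Tendsto (fun x : ℝ => 12 * exp (-(ε / 8 * √x))) atTop (nhds (12 * 0)) :=
      (tendsto_exp_neg_atTop_nhds_zero.comp
        (tendsto_sqrt_atTop.const_mul_atTop (by positivity))).const_mul 12
    rw [mul_zero] at h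
    filter_upwards [h.eventually (gt_mem_nhds hη)] with x hx using hx.le
  exact eventually_atTop.1 (hN.eventually (h1.and (h2.and (h3.and (h4.and h5)))))

/-- Consequences of `d ≤ √(x / (2 log x))`. -/
lemma diam_estimates {x d : ℝ} (hd0 : 0 ≤ d) (hx : 2 ≤ log x) (hx0 : 0 < x)
    (hd : d ≤ √(x / (2 * log x))) :
    d * √(x * log x) ≤ x ∧ log x * d ≤ √(x * log x) ∧ 2 * d ≤ √x ∧ √x ≤ √(x * log x) := by
  have hq : 0 < log x := by linarith
  have hd2 : d ^ 2 ≤ x / (2 * log x) := by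
    have := pow_le_pow_left₀ hd0 hd 2
    rwa [sq_sqrt (by positivity)] at this
  rw [le_div_iff₀ (by positivity)] at hd2
  have hL := sq_sqrt (show 0 ≤ x * log x by positivity)
  refine ⟨?_, ?_, ?_, ?_⟩
  · refine le_of_sq_le_sq ?_ hx0.le
    rw [mul_pow, hL]
    nlinarith [mul_le_mul_of_nonneg_left hd2 hx0.le, sq_nonneg d, mul_nonneg (sq_nonneg d) hq.le]
  · refine le_sqrt_of_sq_le ?_
    nlinarith [mul_le_mul_of_nonneg_left hd2 hq.le]
  · refine le_sqrt_of_sq_le ?_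
    nlinarith [mul_le_mul_of_nonneg_left hx (sq_nonneg d)]
  · refine sqrt_le_sqrt ?_
    nlinarith

/-- An upper bound for the proportion of words that are not typical. -/
lemma nontypical_estimate {ε x L : ℝ} {n : ℕ} (hε : 0 < ε) (hd : 2 ≤ n + 1) (hx0 : 0 < x)
    (hqd : log x * (n + 1) ≤ L) (h2d : 2 * ((n : ℝ) + 1) ≤ √x) (h3 : 64 ≤ ε * exp (L / 2)) :
    (2 ^ (n + 1) * (n + 1).factorial + 2 * ((n : ℝ) + 1) ^ 2) * (3 * exp (-L)) ≤ ε / 8 := by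
  have hn2 : (2 : ℝ) ≤ n + 1 := by exact_mod_cast hd
  set E := exp (-L) with hE
  have hE0 : 0 < E := exp_pos _
  have hpow : (2 * ((n : ℝ) + 1)) ^ (n + 1) ≤ exp (L / 2) := by
    -- (2d)^d ≤ x^(d/2) = exp(d log x / 2) ≤ exp(L/2), which dominates both 2^d d! and 2d².
    refine (pow_le_pow_left₀ (by positivity) h2d _).trans ?_
    have : √x = exp (log x / 2) := by
      rw [sqrt_eq_rpow, Real.rpow_def_of_pos hx0]; congr 1; ring
    rw [this, ← exp_nat_mul]
    refine exp_le_exp.2 ?_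
    push_cast
    linarith
  have h1 : (2 : ℝ) ^ (n + 1) * (n + 1).factorial ≤ exp (L / 2) := by
    refine le_trans ?_ hpow
    rw [mul_pow]
    refine mul_le_mul_of_nonneg_left ?_ (by positivity)
    exact_mod_cast Nat.factorial_le_pow (n + 1)
  have h2 : 2 * ((n : ℝ) + 1) ^ 2 ≤ exp (L / 2) := by
    refine le_trans ?_ hpow
    refine le_trans ?_ (pow_le_pow_right₀ (show 1 ≤ 2 * ((n : ℝ) + 1) by linarith) hd)
    nlinarith [sq_nonneg ((n : ℝ) + 1)]
  have h4 : exp (L / 2) * exp (L / 2) * E = 1 := by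
    rw [hE, ← exp_add, ← exp_add]; simp
  calc _ ≤ (exp (L / 2) + exp (L / 2)) * (3 * E) :=
        mul_le_mul_of_nonneg_right (by linarith) (by positivity)
    _ = 6 * (exp (L / 2) * E) := by ring
    _ ≤ ε / 8 := by
        have h5 := mul_le_mul_of_nonneg_right h3
          (show 0 ≤ exp (L / 2) * E by positivity)
        have h6 : ε * exp (L / 2) * (exp (L / 2) * E) = ε := by
          rw [show ε * exp (L / 2) * (exp (L / 2) * E) =
            ε * (exp (L / 2) * exp (L / 2) * E) by ring, h4, mul_one]
        linarith

/-- An upper bound for the correlation term in Janson's inequality. -/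
lemma correlation_estimate {ε x L N p₀ : ℝ} {n : ℕ} (hε : 0 < ε) (hε1 : ε < 1) (hx1 : 1 ≤ x)
    (hexpx : exp x = N) (hp₀pos : 0 < p₀)
    (hlam : (1 + ε) * x = 2 ^ (n + 1) * N ^ n * p₀ ^ (n + 1))
    (hdL : ((n : ℝ) + 1) * L ≤ x) (h2d : 2 * ((n : ℝ) + 1) ≤ √x) (hcube : 4 * x ^ 3 ≤ exp L) :
    ((1 + ε) * x) ^ 2 * ((1 + ((n : ℝ) + 1) / (N * p₀)) ^ (n + 1) - 1) ≤ 1 := by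
  have hx0 : 0 < x := by linarith
  have hNpos : 0 < N := hexpx ▸ exp_pos x
  have hlam0 : 0 ≤ (1 + ε) * x := by positivity
  set E := exp (-L) with hE
  have hE0 : 0 < E := exp_pos _
  set t := ((n : ℝ) + 1) / (N * p₀) with ht
  have ht0 : 0 ≤ t := by positivity
  -- The d-th power of 2Np₀ is Nλ ≥ N = e^x ≥ e^(dL).
  have hNp : exp L ≤ 2 * N * p₀ := by
    refine le_of_pow_le_pow_left₀ (Nat.succ_ne_zero n) (by positivity) ?_
    have h1 : (2 * N * p₀) ^ (n + 1) = N * ((1 + ε) * x) := by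
      rw [hlam, mul_pow, mul_pow]; ring
    rw [Nat.succ_eq_add_one, h1, ← exp_nat_mul]
    calc exp (((n + 1 : ℕ) : ℝ) * L) ≤ exp x :=
          exp_le_exp.2 (by push_cast; exact hdL)
      _ = N := hexpx
      _ ≤ N * ((1 + ε) * x) := le_mul_of_one_le_right hNpos.le (by nlinarith)
  have ht1 : t ≤ 2 * (n + 1) * E := by
    rw [ht, div_le_iff₀ (by positivity)]
    have h1 : 1 ≤ E * (2 * N * p₀) := by
      calc (1 : ℝ) = E * exp L := by rw [hE, ← exp_add]; simp
        _ ≤ _ := mul_le_mul_of_nonneg_left hNp hE0.le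
    nlinarith
  have hsq : 4 * ((n : ℝ) + 1) ^ 2 ≤ x := by
    have := pow_le_pow_left₀ (by positivity) h2d 2
    rw [Real.sq_sqrt hx0.le] at this
    nlinarith
  have htd : t * (n + 1) ≤ x * E / 2 := by
    have h1 := mul_le_mul_of_nonneg_right ht1 (show (0 : ℝ) ≤ n + 1 by positivity)
    have h2 := mul_le_mul_of_nonneg_right hsq hE0.le
    nlinarith
  have hxE : 4 * x ^ 3 * E ≤ 1 := by
    have h1 : 4 * x ^ 3 ≤ exp L := hcube
    calc 4 * x ^ 3 * E ≤ exp L * E := mul_le_mul_of_nonneg_right h1 hE0.le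
      _ = 1 := by rw [hE, ← exp_add]; simp
  have hx3 : x ≤ x ^ 3 := le_self_pow₀ (by linarith) (by norm_num)
  have hxE' : x * E ≤ x ^ 3 * E := mul_le_mul_of_nonneg_right hx3 hE0.le
  have htd0 : 0 ≤ t * (n + 1) := by positivity
  have hpow : (1 + t) ^ (n + 1) - 1 ≤ x * E := by
    have h1 : (1 + t) ^ (n + 1) ≤ exp (t * (n + 1)) := by
      have := pow_le_pow_left₀ (by positivity)
        (show 1 + t ≤ exp t by linarith [Real.add_one_le_exp t]) (n + 1)
      refine this.trans (le_of_eq ?_)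
      rw [← exp_nat_mul]
      push_cast
      rw [mul_comm]
    have h2 := Real.abs_exp_sub_one_le (x := t * (n + 1)) (by
      rw [abs_of_nonneg htd0]
      have : 0 ≤ x ^ 3 * E := by positivity
      linarith)
    rw [abs_of_nonneg htd0] at h2
    have h3 := (le_abs_self _).trans h2
    linarith
  calc _ ≤ (2 * x) ^ 2 * (x * E) := by
        refine mul_le_mul (pow_le_pow_left₀ hlam0 (by nlinarith) 2) hpow ?_ (by positivity)
        exact sub_nonneg.2 (one_le_pow₀ (by linarith))
    _ = 4 * x ^ 3 * E := by ring
    _ ≤ 1 := hxE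

end Asymptotics

/-! ### The union bound -/

section UnionBound

open Real

variable {G : Type*} [Group G] [Fintype G] [DecidableEq G]

/-- Janson's inequality gives a bound for the probability that `g` is not the value of a word in
the random set. -/
lemma bernoulliExp_avoid_wordSets_le {n R : ℕ} (hR : commPairs G ≤ R ^ 2)
    (hR' : commPairs G ≤ Fintype.card G * R) {g : G} (hg : g ≠ 1) (hn : 1 ≤ n) {p lam t δ : ℝ}
    (hp : 0 < p) (hp1 : p ≤ 1) (hlam : lam = 2 ^ (n + 1) * (Fintype.card G : ℝ) ^ n * p ^ (n + 1))
    (ht : t = (n + 1) / (Fintype.card G * p)) (hcorr : lam ^ 2 * ((1 + t) ^ (n + 1) - 1) ≤ 1)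
    (hδ : (2 ^ (n + 1) * (n + 1).factorial + 2 * (n + 1) ^ 2) * (R / Fintype.card G) ≤ δ) :
    bernoulliExp p Finset.univ (avoidInd (wordSets n R g)) ≤
      exp (1 - lam * (1 - δ) / symmetryBound n R g) := by
  refine (janson_inequality hp.le hp1 _ fun B _ => Finset.subset_univ B).trans
    (exp_le_exp.2 ?_)
  have h1 := (sum_correlation_le (R := R) g hp ht hlam).trans hcorr
  have h2 := le_symmetryBound_mul_sum hR hR' hg hn hp hlam
  have hlam0 : 0 ≤ lam := by rw [hlam]; positivity
  have hs : (0 : ℝ) < symmetryBound n R g := by exact_mod_cast symmetryBound_pos R g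
  have h3 : lam * (1 - δ) / symmetryBound n R g ≤ ∑ A ∈ wordSets n R g, p ^ A.card := by
    rw [div_le_iff₀' hs]
    refine le_trans (mul_le_mul_of_nonneg_left ?_ hlam0) h2
    linarith
  linarith

/-- Summation over all `g`, grouped by the value of `symmetryBound`. -/
lemma sum_exp_symmetryBound_le {n R : ℕ} {M x μ ε : ℝ} (hM : 0 < M)
    (hx : x = log (Fintype.card G)) (hx0 : 0 ≤ x) (hε : 0 ≤ ε)
    (hMR : Fintype.card G / M ≤ R) (hμ : (1 + 3 * ε / 4) * x ≤ μ)
    (ha : ({x : G | x ^ 2 = 1}.ncard : ℝ) ≤ (Fintype.card G : ℝ) ^ ((2 + ε) / 4))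
    (hb : ({x : G | (classSize x : ℝ) ≤ M}.ncard : ℝ) ≤
      (Fintype.card G : ℝ) ^ (1 / ((n + 1 : ℕ) : ℝ)))
    (hc : ({x : G | x ^ 2 = 1 ∧ (classSize x : ℝ) ≤ M}.ncard : ℝ) ≤
      (Fintype.card G : ℝ) ^ (1 / (2 * ((n + 1 : ℕ) : ℝ)))) :
    ∑ g : G, exp (1 - μ / symmetryBound n R g) ≤
      4 * exp (1 - ε / 8 * (x / (n + 1))) := by
  classical
  have hcard : (0 : ℝ) < Fintype.card G := by exact_mod_cast Fintype.card_pos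
  have hrpow : ∀ y : ℝ, (Fintype.card G : ℝ) ^ y = exp (x * y) := fun y => by
    rw [rpow_def_of_pos hcard, hx]
  have hn0 : (0 : ℝ) < n + 1 := by positivity
  have hn1 : x / (n + 1) ≤ x := div_le_self hx0 (by linarith [Nat.cast_nonneg (α := ℝ) n])
  have hxn : 0 ≤ x / (n + 1) := by positivity
  have hind : ∀ (P : G → Prop) [DecidablePred P] (c : ℝ),
      ∑ g : G, (if P g then c else 0) = {g : G | P g}.ncard * c := by
    intro P _ c
    rw [← Finset.sum_filter, Finset.sum_const, nsmul_eq_mul, Set.ncard_eq_toFinset_card',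
      Set.toFinset_ofPred]
  -- One term for each value 1, 2, d, 2d of the symmetry bound; by `hMR` a centralizer of order
  -- above R forces a class of size at most M.
  have hpt : ∀ g : G, exp (1 - μ / symmetryBound n R g) ≤
      exp (1 - μ) + (if g ^ 2 = 1 then exp (1 - μ / 2) else 0) +
        (if (classSize g : ℝ) ≤ M then exp (1 - μ / (n + 1)) else 0) +
        (if g ^ 2 = 1 ∧ (classSize g : ℝ) ≤ M then exp (1 - μ / ((n + 1) * 2)) else 0) := by
    intro g
    have e0 : 0 ≤ exp (1 - μ) := (exp_pos _).le
    have e1 : 0 ≤ (if g ^ 2 = 1 then exp (1 - μ / 2) else 0) := by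
      split_ifs <;> first | exact (exp_pos _).le | exact le_rfl
    have e2 : 0 ≤ (if (classSize g : ℝ) ≤ M then exp (1 - μ / (n + 1)) else 0) := by
      split_ifs <;> first | exact (exp_pos _).le | exact le_rfl
    have e3 : 0 ≤ (if g ^ 2 = 1 ∧ (classSize g : ℝ) ≤ M then
        exp (1 - μ / ((n + 1) * 2)) else 0) := by
      split_ifs <;> first | exact (exp_pos _).le | exact le_rfl
    have hcl : ¬ centCard g ≤ R → (classSize g : ℝ) ≤ M := by
      intro h
      by_contra hlt
      have := (centCard_le_div hM (not_le.1 hlt)).trans hMR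
      exact h (by exact_mod_cast this)
    rw [symmetryBound]
    by_cases h1 : centCard g ≤ R <;> by_cases h2 : g * g = 1
    · rw [if_pos h1, if_pos h2]
      rw [if_pos (show g ^ 2 = 1 by rw [sq, h2])] at e1 ⊢
      norm_num
      linarith
    · rw [if_pos h1, if_neg h2]
      norm_num
      linarith
    · rw [if_neg h1, if_pos h2]
      have h3 : g ^ 2 = 1 ∧ (classSize g : ℝ) ≤ M := ⟨by rw [sq, h2], hcl h1⟩
      rw [if_pos h3] at e3 ⊢
      push_cast
      linarith
    · rw [if_neg h1, if_neg h2]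
      rw [if_pos (hcl h1)] at e2 ⊢
      push_cast
      rw [mul_one]
      linarith
  refine (Finset.sum_le_sum fun g _ => hpt g).trans ?_
  rw [Finset.sum_add_distrib, Finset.sum_add_distrib, Finset.sum_add_distrib, hind, hind, hind,
    Finset.sum_const, nsmul_eq_mul, Finset.card_univ]
  have hterm : ∀ {m y z : ℝ}, m ≤ exp y → y + z ≤ 1 - ε / 8 * (x / (n + 1)) →
      m * exp z ≤ exp (1 - ε / 8 * (x / (n + 1))) := fun hm hyz =>
    (mul_le_mul_of_nonneg_right hm (exp_pos _).le).trans
      (by rw [← exp_add]; exact exp_le_exp.2 hyz)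
  have hεx : ε * (x / (n + 1)) ≤ ε * x := mul_le_mul_of_nonneg_left hn1 hε
  have hεxn : 0 ≤ ε * (x / (n + 1)) := mul_nonneg hε hxn
  have hμn : (1 + 3 * ε / 4) * (x / (n + 1)) ≤ μ / (n + 1) := by
    rw [← mul_div_assoc]
    exact div_le_div_of_nonneg_right hμ hn0.le
  have hhalf : μ / ((n + 1) * 2) = μ / (n + 1) / 2 := by rw [div_div]
  -- Dropping the common constant 1, the exponents are at most -3εx/4, -εx/8, -3εx/(4d) and
  -- -3εx/(8d). The second is where the exponent (2+ε)/4 of (a) is used: (2+ε)/4 - (1+3ε/4)/2 =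
  -- -ε/8.
  have t1 := hterm (m := (Fintype.card G : ℝ)) (y := x) (z := 1 - μ)
    (by rw [hx, exp_log hcard]) (by linarith)
  have t2 := hterm (z := 1 - μ / 2) (ha.trans_eq (hrpow _)) (by linarith)
  have t3 := hterm (z := 1 - μ / (n + 1)) (hb.trans_eq (hrpow _)) (by
    push_cast; rw [mul_one_div]; linarith)
  have t4 := hterm (z := 1 - μ / ((n + 1) * 2)) (hc.trans_eq (hrpow _)) (by
    push_cast
    rw [hhalf, show x * (1 / (2 * ((n : ℝ) + 1))) = x / (n + 1) / 2 by field_simp]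
    linarith)
  linarith

/-- If few elements have small conjugacy classes, then there are few commuting pairs. -/
lemma exists_commPairs_bound {n : ℕ} {x L : ℝ} (hd : 2 ≤ n + 1) (hexpx : exp x = Fintype.card G)
    (hL0 : 0 ≤ L) (hL4 : 4 * L ≤ x)
    (hb : ({x : G | (classSize x : ℝ) ≤ exp (2 * L)}.ncard : ℝ) ≤
      (Fintype.card G : ℝ) ^ (1 / ((n + 1 : ℕ) : ℝ))) :
    ∃ R : ℕ, commPairs G ≤ R ^ 2 ∧ commPairs G ≤ Fintype.card G * R ∧
      Fintype.card G / exp (2 * L) ≤ R ∧ (R : ℝ) / Fintype.card G ≤ 3 * exp (-L) := by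
  have hn2 : (2 : ℝ) ≤ n + 1 := by exact_mod_cast hd
  have hK := commPairs_le (G := G) (exp_pos (2 * L))
  have hcast : ∀ R : ℕ, ((commPairs G : ℝ) ≤ Fintype.card G * R) →
      commPairs G ≤ Fintype.card G * R := fun R h => by exact_mod_cast h
  have hNpos : (0 : ℝ) < Fintype.card G := hexpx ▸ exp_pos x
  generalize (Fintype.card G : ℝ) = N at *
  set E := exp (-L) with hE
  have hE0 : 0 < E := exp_pos _
  have hE1 : E ≤ 1 := exp_le_one_iff.2 (by linarith)
  have hME : ∀ y : ℝ, y / exp (2 * L) = y * E ^ 2 := fun y => by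
    rw [div_eq_mul_inv, ← exp_neg, hE, sq, ← exp_add]
    congr 2; ring
  have hNE : 1 ≤ N * E := by
    rw [← hexpx, hE, ← exp_add]
    exact one_le_exp (by linarith)
  have hRge : N * (2 * E) ≤ (⌈N * (2 * E)⌉₊ : ℝ) := Nat.le_ceil _
  -- As d ≥ 2 and 4L ≤ x, x/d ≤ x/2 ≤ x - 2L. The two terms of the bound on commuting pairs are then
  -- at most (NE)² each.
  have h2 : N ^ (1 / ((n + 1 : ℕ) : ℝ)) ≤ N * E ^ 2 := by
    rw [← hexpx, ← exp_mul, hE, sq, ← exp_add, ← exp_add]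
    refine exp_le_exp.2 ?_
    push_cast
    rw [mul_one_div]
    have : x / (n + 1) ≤ x / 2 :=
      div_le_div_of_nonneg_left (by linarith) two_pos hn2
    linarith
  have hK' : (commPairs G : ℝ) ≤ 2 * (N * E) ^ 2 := by
    rw [hME] at hK
    refine hK.trans ((add_le_add_left (mul_le_mul_of_nonneg_left (hb.trans h2) hNpos.le) _).trans
      (le_of_eq ?_))
    ring
  have hEE : (N * E) ^ 2 ≤ N * (N * E) := by
    rw [sq, mul_assoc N E]
    exact mul_le_mul_of_nonneg_left (mul_le_of_le_one_left (by positivity) hE1) hNpos.le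
  -- Rounding up costs at most 1 ≤ NE, whence the constant 3 in the last bound.
  refine ⟨⌈N * (2 * E)⌉₊, ?_, hcast _ ?_, ?_, ?_⟩
  · have h1 := pow_le_pow_left₀ (by positivity) hRge 2
    have h3 : (commPairs G : ℝ) ≤ (⌈N * (2 * E)⌉₊ : ℝ) ^ 2 := by
      linarith [sq_nonneg (N * E), show (N * (2 * E)) ^ 2 = 4 * (N * E) ^ 2 by ring]
    exact_mod_cast h3
  · have h1 := mul_le_mul_of_nonneg_left hRge hNpos.le
    linarith [show N * (N * (2 * E)) = 2 * (N * (N * E)) by ring]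
  · rw [hME]
    refine le_trans ?_ hRge
    refine mul_le_mul_of_nonneg_left ?_ hNpos.le
    nlinarith
  · rw [div_le_iff₀ hNpos]
    have := Nat.ceil_lt_add_one (show 0 ≤ N * (2 * E) by positivity)
    linarith

end UnionBound

/-! ### Choice of parameters and conclusion -/

theorem theorem6 :
    ∃ ε₀ : ℝ, 0 < ε₀ ∧ ∀ ε : ℝ, 0 < ε → ε < ε₀ → ∀ γ : ℝ, 0 < γ → γ < 1 →
      -- with high probability: the error is at most `η` once `N` is large, uniformly in the rest
      ∀ η : ℝ, 0 < η → ∃ N₀ : ℕ, ∀ N : ℕ, N₀ ≤ N →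
        ∀ d : ℕ, 2 ≤ d → (d : ℝ) ≤ diamRange γ N →
        ∀ (G : Type*) [Group G] [Finite G], Nat.card G = N →
          ({x : G | x ^ 2 = 1}.ncard : ℝ) ≤ (N : ℝ) ^ ((2 + ε) / 4) →
          ({x : G | (classSize x : ℝ) ≤ classBound N}.ncard : ℝ) ≤ (N : ℝ) ^ (1 / (d : ℝ)) →
          ({x : G | x ^ 2 = 1 ∧ (classSize x : ℝ) ≤ classBound N}.ncard : ℝ)
            ≤ (N : ℝ) ^ (1 / (2 * (d : ℝ))) →
          ∀ p : I,
            ((1 + ε) / 2 ^ d * (Real.log N / (N : ℝ) ^ (d - 1))) ^ (1 / (d : ℝ)) ≤ (p : ℝ) →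
            1 - η ≤ probDiamLE G p d := by
  classical
  -- ε < 1 is what gives (1+ε)(1-ε/8) ≥ 1 + 3ε/4 below, and λ ≤ 2x in the correlation term.
  refine ⟨1, one_pos, fun ε hε hε1 γ hγ _ η hη => ?_⟩
  obtain ⟨N₀, hN₀⟩ := eventually_log_large ε η hε hη
  refine ⟨N₀, fun N hN d hd hdr G _ _ hG ha hb hc p hp => ?_⟩
  obtain ⟨hq, hq16, hcube, hexp, hηx⟩ := hN₀ N hN
  have := Fintype.ofFinite G
  rw [Nat.card_eq_fintype_card] at hG
  subst hG
  obtain ⟨n, rfl⟩ : ∃ n, d = n + 1 := ⟨d - 1, by omega⟩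
  have hn : 1 ≤ n := by omega
  rw [Nat.add_sub_cancel] at hp
  set N : ℝ := (Fintype.card G : ℝ) with hNdef
  set x := Real.log N with hx
  set L := √(x * Real.log x) with hL
  have hNpos : 0 < N := by rw [hNdef]; exact_mod_cast Fintype.card_pos
  have hx32 : 32 ≤ x := by linarith
  have hx0 : 0 < x := by linarith
  have hexpx : Real.exp x = N := Real.exp_log hNpos
  have hd' : ((n + 1 : ℕ) : ℝ) ≤ √(x / (2 * Real.log x)) := by
    refine hdr.trans ?_
    rw [diamRange]
    exact mul_le_of_le_one_left (Real.sqrt_nonneg _) (by linarith)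
  push_cast at hd'
  obtain ⟨hdL, hqd, h2d, hsL⟩ := diam_estimates (by positivity) hq hx0 hd'
  rw [← hL] at hdL hqd hsL
  have hL4 : 4 * L ≤ x := by
    rw [hL]
    refine le_of_sq_le_sq ?_ hx0.le
    rw [mul_pow, Real.sq_sqrt (by positivity)]
    have := mul_le_mul_of_nonneg_left hq16 hx0.le
    linarith
  have hL1 : 1 ≤ L := (Real.one_le_sqrt.2 (by linarith)).trans hsL
  have hsymm : classBound (Fintype.card G) = Real.exp (2 * L) := rfl
  rw [hsymm] at hb hc
  have hM0 : 0 < Real.exp (2 * L) := Real.exp_pos _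
  obtain ⟨R, hR, hR', hMR, hRN⟩ := exists_commPairs_bound (G := G) hd hexpx (by linarith) hL4 hb
  -- the proportion of words that are not typical
  have hfrac : (2 ^ (n + 1) * (n + 1).factorial + 2 * (n + 1) ^ 2) *
      (R / Fintype.card G) ≤ ε / 8 := by
    exact (mul_le_mul_of_nonneg_left hRN (by positivity)).trans
      (nontypical_estimate hε hd hx0 hqd h2d (hexp.trans
        (mul_le_mul_of_nonneg_left (Real.exp_le_exp.2 (by linarith)) hε.le)))
  -- the threshold
  set p₀ : ℝ := ((1 + ε) / 2 ^ (n + 1) * (x / N ^ n)) ^ (1 / ((n + 1 : ℕ) : ℝ)) with hp₀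
  have hbase : 0 < (1 + ε) / 2 ^ (n + 1) * (x / N ^ n) := by positivity
  have hp₀pos : 0 < p₀ := Real.rpow_pos_of_pos hbase _
  have hp₀1 : p₀ ≤ 1 := hp.trans p.2.2
  have hp₀pow : p₀ ^ (n + 1) = (1 + ε) / 2 ^ (n + 1) * (x / N ^ n) := by
    rw [hp₀, one_div, Real.rpow_inv_natCast_pow hbase.le (Nat.succ_ne_zero n)]
  have hlam : (1 + ε) * x = 2 ^ (n + 1) * (Fintype.card G : ℝ) ^ n * p₀ ^ (n + 1) := by
    rw [hp₀pow, ← hNdef]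
    field_simp
  have hlam0 : 0 ≤ (1 + ε) * x := by positivity
  have hcorr : ((1 + ε) * x) ^ 2 *
      ((1 + ((n : ℝ) + 1) / (Fintype.card G * p₀)) ^ (n + 1) - 1) ≤ 1 := by
    rw [← hNdef]
    exact correlation_estimate hε hε1 (by linarith) hexpx hp₀pos (by rw [hlam, ← hNdef]) hdL h2d
      (hcube.trans (Real.exp_le_exp.2 hsL))
  -- the union bound
  have hsum : ∑ g ∈ Finset.univ.erase (1 : G),
      bernoulliExp (p : ℝ) Finset.univ (avoidInd (wordSets n R g)) ≤
        ∑ g : G, Real.exp (1 - (1 + ε) * x * (1 - ε / 8) / symmetryBound n R g) := by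
    refine (Finset.sum_le_sum fun g hg => ?_).trans (Finset.sum_le_sum_of_subset_of_nonneg
      (Finset.erase_subset _ _) fun _ _ _ => (Real.exp_pos _).le)
    -- Missing g becomes less likely as p grows, so p is lowered to p₀, where λ = (1+ε) log N
    -- exactly.
    exact (bernoulliExp.mono_prob hp₀pos.le hp p.2.2 (avoidInd_antitone _)).trans
      (bernoulliExp_avoid_wordSets_le hR hR' (Finset.ne_of_mem_erase hg) hn hp₀pos hp₀1 hlam rfl
        hcorr hfrac)
  have hμ : (1 + 3 * ε / 4) * x ≤ (1 + ε) * x * (1 - ε / 8) := by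
    have : 0 ≤ (ε / 8 * (1 - ε)) * x :=
      mul_nonneg (mul_nonneg (by linarith) (by linarith)) hx0.le
    nlinarith
  have htotal := sum_exp_symmetryBound_le (G := G) (n := n) hM0 hx hx0.le hε.le hMR hμ ha hb hc
  have hlast : 4 * Real.exp (1 - ε / 8 * (x / (n + 1))) ≤ η := by
    refine le_trans ?_ hηx
    rw [sub_eq_add_neg, Real.exp_add]
    -- √x ≤ L ≤ x/d, so the bound tends to 0 uniformly in d; the factor 12 in `hηx` covers 4e.
    have h1 : √x ≤ x / (n + 1) := by
      rw [le_div_iff₀ (by positivity), mul_comm]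
      exact (mul_le_mul_of_nonneg_left hsL (by positivity)).trans hdL
    have h2 : Real.exp (-(ε / 8 * (x / (n + 1)))) ≤ Real.exp (-(ε / 8 * √x)) :=
      Real.exp_le_exp.2 (neg_le_neg (mul_le_mul_of_nonneg_left h1 (by positivity)))
    rw [← mul_assoc]
    exact mul_le_mul (by linarith [Real.exp_one_lt_d9]) h2 (Real.exp_pos _).le (by norm_num)
  have := one_sub_sum_le_probDiamLE (G := G) n R p
  linarith
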